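/- Let $Q$ be a finite-dimensional, Hausdorff, paracompact real-analytic manifold and let $\nabla$ be an analytic affine connection on $Q$. An (analytic) distribution on an analytic manifold $M$, possibly of varying rank, is a family of subspaces $\mathcal F_x\subseteq T_xM$ such that every $u\in\mathcal F_x$ is the value at $x$ of an analytic vector field $Y$ defined on an open neighbourhood $U$ of $x$ with $Y(y)\in\mathcal F_y$ for all $y\in U$ (a local section of $\mathcal F$). It is invariant under a vector field $Z$ if $[Z,\xi]$ takes values in $\mathcal F$ for every local section $\xi$ of $\mathcal F$. For $v_q\in T_qQ$ let $\mathrm{vlft}_{v_q}(w)=\frac{d}{dt}\big|_{t=0}(v_q+tw)$ be the vertical lift and $\mathrm{hlft}_{v_q}$ the horizontal lift of $\nabla$, given in coordinates $(q^i,v^i)$ by $\mathrm{hlft}_{v_q}(u)=u^i\big(\frac{\partial}{\partial q^i}-\Gamma^j_{ik}(q)v^k\frac{\partial}{\partial v^j}\big)$, where $\nabla_{\partial_i}\partial_k=\Gamma^j_{ik}\partial_j$. They define the isomorphism $T_qQ\oplus T_qQ\to T_{v_q}TQ$, $(a,b)\mapsto \mathrm{hlft}_{v_q}(a)+\mathrm{vlft}_{v_q}(b)$.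 Let $Z(v_q)=\mathrm{hlft}_{v_q}(v_q)$ be the geodesic spray. Let $\mathcal D$ be an analytic distribution on $Q$ to which $\nabla$ restricts, that is, $\nabla_XY$ takes values in $\mathcal D$ for all local analytic vector fields $X$ and all local sections $Y$ of $\mathcal D$. Suppose that the torsion $T$ of $\nabla$ satisfies $T(u,w)\in\mathcal D_q$ for all $q\in Q$ and $u,w\in\mathcal D_q$ (for instance, that $\nabla$ is torsion-free). Then among the analytic distributions on $TQ$ that contain the vertical lift of $\mathcal D$ (that is, contain $\mathrm{vlft}_{v_q}(w)$ for all $v_q\in TQ$ and $w\in\mathcal D_q$) and are invariant under $Z$ there is a smallest one, $\mathcal D^Z$, and for every $v_q\in\mathcal D$ the isomorphism above maps $\mathcal D_q\oplus\mathcal D_q$ onto $\mathcal D^Z(v_q)$: $$\mathcal D^Z(v_q)=\{\mathrm{hlft}_{v_q}(a)+\mathrm{vlft}_{v_q}(b)\;:\;a,b\in\mathcal D_q\}\;\simeq\;\mathcal D_q\oplus\mathcal D_q .$$ -/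

import Mathlib

open scoped Manifold ContDiff Topology Bundle

noncomputable section

namespace AffineSpray

section Distributions

variable {E : Type*} [NormedAddCommGroup E] [NormedSpace ℝ E]
  {H : Type*} [TopologicalSpace H] (I : ModelWithCorners ℝ E H)
  {M : Type*} [TopologicalSpace M] [ChartedSpace H M] [IsManifold I 1 M]

/-- `Y` is an analytic vector field on the set `U` (its values off `U` are irrelevant). -/
def IsAnalyticFieldOn (Y : ∀ x : M, TangentSpace I x) (U : Set M) : Prop :=
  ContMDiffOn I I.tangent ω (fun x => (⟨x, Y x⟩ : TangentBundle I M)) U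

/-- `Y` is a local analytic section over `U` of the family `D` of tangent subspaces. -/
def IsSectionOn (D : ∀ x : M, Submodule ℝ (TangentSpace I x))
    (Y : ∀ x : M, TangentSpace I x) (U : Set M) : Prop :=
  IsAnalyticFieldOn I Y U ∧ ∀ x ∈ U, Y x ∈ D x

/-- An analytic distribution (of possibly varying rank): a family of tangent subspaces such that
every vector of the family is a value of a local analytic section of the family. -/
def IsAnalyticDistribution (D : ∀ x : M, Submodule ℝ (TangentSpace I x)) : Prop :=
  ∀ x : M, ∀ u ∈ D x, ∃ U : Set M, IsOpen U ∧ x ∈ U ∧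
    ∃ Y : ∀ y : M, TangentSpace I y, IsSectionOn I D Y U ∧ Y x = u

/-- The distribution `D` is invariant under the vector field `Z`: the Lie bracket of `Z` with
every local analytic section of `D` takes values in `D`. -/
def IsInvariantUnder (Z : ∀ x : M, TangentSpace I x)
    (D : ∀ x : M, Submodule ℝ (TangentSpace I x)) : Prop :=
  ∀ (U : Set M) (ξ : ∀ x : M, TangentSpace I x), IsOpen U → IsSectionOn I D ξ U →
    ∀ x ∈ U, VectorField.mlieBracket I Z ξ x ∈ D x

end Distributions

section Connection

variable {E : Type*} [NormedAddCommGroup E] [NormedSpace ℝ E]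
  {Q : Type*} [TopologicalSpace Q] [ChartedSpace E Q] [IsManifold 𝓘(ℝ, E) ω Q]

/-- The affine connection is analytic: it maps analytic vector fields on any open set `U` to
analytic tensor fields on `U`. (`cov Y x u` is the value at `x` of `∇_u Y`.) -/
def IsAnalyticConnection
    (cov : CovariantDerivative 𝓘(ℝ, E) E (TangentSpace 𝓘(ℝ, E) : Q → Type _)) : Prop :=
  ∀ U : Set Q, IsOpen U → ContMDiffCovariantDerivativeOn E ω cov.toFun U

/-- The connection restricts to `D`: for local analytic vector fields `X` and local analytic
sections `Y` of `D`, the field `∇_X Y` takes values in `D`. -/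
def RestrictsTo
    (cov : CovariantDerivative 𝓘(ℝ, E) E (TangentSpace 𝓘(ℝ, E) : Q → Type _))
    (D : ∀ q : Q, Submodule ℝ (TangentSpace 𝓘(ℝ, E) q)) : Prop :=
  ∀ (U : Set Q) (X Y : ∀ q : Q, TangentSpace 𝓘(ℝ, E) q), IsOpen U →
    IsAnalyticFieldOn 𝓘(ℝ, E) X U → IsSectionOn 𝓘(ℝ, E) D Y U →
    ∀ q ∈ U, cov Y q (X q) ∈ D q

/-- The inclusion of the fibre `T_q Q` (with underlying vector space `E`) in `TQ`. -/
def fibreIncl (q : Q) (w : E) : TangentBundle 𝓘(ℝ, E) Q := ⟨q, w⟩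

/-- The vertical lift `T_q Q → T_v TQ` at `v ∈ T_q Q`, `w ↦ d/dt|₀ (v + t w)`: the derivative at
`v` of the inclusion of the fibre `T_q Q` in `TQ`. -/
def vlift (v : TangentBundle 𝓘(ℝ, E) Q) :
    TangentSpace 𝓘(ℝ, E) v.proj →L[ℝ] TangentSpace 𝓘(ℝ, E).tangent v :=
  mfderiv 𝓘(ℝ, E) 𝓘(ℝ, E).tangent (fibreIncl (E := E) v.proj) v.snd

/-- The horizontal lift `T_q Q → T_v TQ` at `v ∈ T_q Q`. For any local vector field `σ` with
`σ q = v`, the horizontal lift of `u` is `T_q σ (u)` minus the vertical lift of `∇_u σ`; as `σ` we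
take the extension of `v` which is constant in the chart at `q`. In coordinates this is
`u ↦ uⁱ (∂/∂qⁱ - Γʲᵢₖ vᵏ ∂/∂vʲ)`. -/
def hlift (cov : CovariantDerivative 𝓘(ℝ, E) E (TangentSpace 𝓘(ℝ, E) : Q → Type _))
    (v : TangentBundle 𝓘(ℝ, E) Q) :
    TangentSpace 𝓘(ℝ, E) v.proj →L[ℝ] TangentSpace 𝓘(ℝ, E).tangent v :=
  let dσ : TangentSpace 𝓘(ℝ, E) v.proj →L[ℝ] TangentSpace 𝓘(ℝ, E).tangent v :=
    mfderiv 𝓘(ℝ, E) 𝓘(ℝ, E).tangent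
      (fun x : Q => (⟨x, FiberBundle.extend E v.snd x⟩ : TangentBundle 𝓘(ℝ, E) Q)) v.proj
  dσ - (vlift v).comp (cov (FiberBundle.extend E v.snd) v.proj)

/-- The family `F` of tangent subspaces of `TQ` contains the vertical lift of `D`. -/
def ContainsVerticalLift (D : ∀ q : Q, Submodule ℝ (TangentSpace 𝓘(ℝ, E) q))
    (F : ∀ v : TangentBundle 𝓘(ℝ, E) Q, Submodule ℝ (TangentSpace 𝓘(ℝ, E).tangent v)) : Prop :=
  ∀ v : TangentBundle 𝓘(ℝ, E) Q, ∀ w ∈ D v.proj, vlift v w ∈ F v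

/-- The geodesic spray: the horizontal lift of `v` at `v`. -/
def spray (cov : CovariantDerivative 𝓘(ℝ, E) E (TangentSpace 𝓘(ℝ, E) : Q → Type _))
    (v : TangentBundle 𝓘(ℝ, E) Q) : TangentSpace 𝓘(ℝ, E).tangent v :=
  hlift cov v v.snd

/-- The fibre coordinate in the chart at `q`. -/
def fibreCoord (q : Q) (p : TangentBundle 𝓘(ℝ, E) Q) : E :=
  (trivializationAt E (TangentSpace 𝓘(ℝ, E)) q p).2

lemma fibreCoord_fibreIncl (q : Q) : fibreCoord (E := E) q ∘ fibreIncl q = id := by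
  funext w
  exact (tangentBundleCore 𝓘(ℝ, E) Q).coordChange_self (achart E q) q (mem_chart_source E q) w

lemma mdifferentiableAt_fibreIncl (q : Q) (v : E) :
    MDifferentiableAt 𝓘(ℝ, E) 𝓘(ℝ, E).tangent (fibreIncl (E := E) q) v := by
  rw [mdifferentiableAt_totalSpace]
  refine ⟨mdifferentiableAt_const, ?_⟩
  have h : MDifferentiableAt 𝓘(ℝ, E) 𝓘(ℝ, E) (fibreCoord (E := E) q ∘ fibreIncl q) v := by
    rw [fibreCoord_fibreIncl]
    exact mdifferentiableAt_id
  exact h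

lemma mdifferentiableAt_fibreCoord (p : TangentBundle 𝓘(ℝ, E) Q) :
    MDifferentiableAt 𝓘(ℝ, E).tangent 𝓘(ℝ, E) (fibreCoord (E := E) p.proj) p :=
  ((mdifferentiableAt_totalSpace 𝓘(ℝ, E) (IM := 𝓘(ℝ, E).tangent)
      (fun p : TangentBundle 𝓘(ℝ, E) Q => p)).1 mdifferentiableAt_id).2

lemma mdifferentiableAt_projection (p : TangentBundle 𝓘(ℝ, E) Q) :
    MDifferentiableAt 𝓘(ℝ, E).tangent 𝓘(ℝ, E)
      (Bundle.TotalSpace.proj : TangentBundle 𝓘(ℝ, E) Q → Q) p :=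
  (Bundle.contMDiffAt_proj (n := 1) (TangentSpace 𝓘(ℝ, E))).mdifferentiableAt one_ne_zero

lemma vlift_injective (v : TangentBundle 𝓘(ℝ, E) Q) : Function.Injective (vlift v) := by
  have h2 := HasMFDerivAt.comp (I := 𝓘(ℝ, E)) (f := fibreIncl (E := E) v.proj) (M := E) v.snd
    (mdifferentiableAt_fibreCoord v).hasMFDerivAt
    (mdifferentiableAt_fibreIncl (E := E) v.proj v.snd).hasMFDerivAt
  rw [fibreCoord_fibreIncl] at h2
  have h3 := hasMFDerivAt_unique h2 (hasMFDerivAt_id _)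
  intro a b hab
  have ha := DFunLike.congr_fun h3 a
  have hb := DFunLike.congr_fun h3 b
  exact ha.symm.trans (Eq.trans (congrArg (mfderiv 𝓘(ℝ, E).tangent 𝓘(ℝ, E)
    (fibreCoord (E := E) v.proj) v) hab) hb)

lemma proj_vlift (v : TangentBundle 𝓘(ℝ, E) Q) (w : TangentSpace 𝓘(ℝ, E) v.proj) :
    mfderiv 𝓘(ℝ, E).tangent 𝓘(ℝ, E) (Bundle.TotalSpace.proj : TangentBundle 𝓘(ℝ, E) Q → Q) v
      (vlift v w) = 0 := by
  have h2 := HasMFDerivAt.comp (I := 𝓘(ℝ, E)) (f := fibreIncl (E := E) v.proj) (M := E) v.snd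
    (mdifferentiableAt_projection v).hasMFDerivAt
    (mdifferentiableAt_fibreIncl (E := E) v.proj v.snd).hasMFDerivAt
  exact DFunLike.congr_fun (hasMFDerivAt_unique h2 (hasMFDerivAt_const (M := E) v.proj _)) w

lemma proj_hlift (cov : CovariantDerivative 𝓘(ℝ, E) E (TangentSpace 𝓘(ℝ, E) : Q → Type _))
    (v : TangentBundle 𝓘(ℝ, E) Q) (u : TangentSpace 𝓘(ℝ, E) v.proj) :
    mfderiv 𝓘(ℝ, E).tangent 𝓘(ℝ, E) (Bundle.TotalSpace.proj : TangentBundle 𝓘(ℝ, E) Q → Q) v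
      (hlift cov v u) = u := by
  have hσ : MDifferentiableAt 𝓘(ℝ, E) 𝓘(ℝ, E).tangent
      (fun x : Q => (⟨x, FiberBundle.extend E v.snd x⟩ : TangentBundle 𝓘(ℝ, E) Q)) v.proj :=
    FiberBundle.mdifferentiableAt_extend 𝓘(ℝ, E) E v.snd
  have hv : (⟨v.proj, FiberBundle.extend E v.snd v.proj⟩ : TangentBundle 𝓘(ℝ, E) Q) = v := by
    rw [FiberBundle.extend_apply_self]
  let D : E × E →L[ℝ] E := mfderiv 𝓘(ℝ, E).tangent 𝓘(ℝ, E)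
    (Bundle.TotalSpace.proj : TangentBundle 𝓘(ℝ, E) Q → Q) v
  have hp : ∀ p : TangentBundle 𝓘(ℝ, E) Q, p = v → HasMFDerivAt 𝓘(ℝ, E).tangent 𝓘(ℝ, E)
      (Bundle.TotalSpace.proj : TangentBundle 𝓘(ℝ, E) Q → Q) p D := by
    rintro _ rfl
    exact (mdifferentiableAt_projection _).hasMFDerivAt
  have h2 := HasMFDerivAt.comp (I := 𝓘(ℝ, E)) v.proj (hp _ hv) hσ.hasMFDerivAt
  have h3 := DFunLike.congr_fun (hasMFDerivAt_unique h2 (hasMFDerivAt_id v.proj)) u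
  have h4 := proj_vlift v (cov (FiberBundle.extend E v.snd) v.proj u)
  refine (map_sub (mfderiv 𝓘(ℝ, E).tangent 𝓘(ℝ, E)
    (Bundle.TotalSpace.proj : TangentBundle 𝓘(ℝ, E) Q → Q) v) _ _).trans ?_
  refine (congrArg₂ (fun a b : E => a - b) h3 h4).trans ?_
  exact sub_zero (u : E)

variable [FiniteDimensional ℝ E]

/-- The torsion `T(X, Y) = ∇_X Y - ∇_Y X - [X, Y]` maps pairs of vectors of `D` to `D`; this holds
in particular if the connection is torsion-free. -/
def TorsionPreserves
    (cov : CovariantDerivative 𝓘(ℝ, E) E (TangentSpace 𝓘(ℝ, E) : Q → Type _))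
    (D : ∀ q : Q, Submodule ℝ (TangentSpace 𝓘(ℝ, E) q)) : Prop :=
  have : CompleteSpace E := FiniteDimensional.complete ℝ E
  ∀ q : Q, ∀ u ∈ D q, ∀ w ∈ D q, cov.torsion q u w ∈ D q

/-- The splitting `T_q Q ⊕ T_q Q ≃ T_v TQ` into horizontal and vertical components defined by the
connection, `(a, b) ↦ hlift a + vlift b`. -/
def splitting (cov : CovariantDerivative 𝓘(ℝ, E) E (TangentSpace 𝓘(ℝ, E) : Q → Type _))
    (v : TangentBundle 𝓘(ℝ, E) Q) :
    (TangentSpace 𝓘(ℝ, E) v.proj × TangentSpace 𝓘(ℝ, E) v.proj) ≃ₗ[ℝ]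
      TangentSpace 𝓘(ℝ, E).tangent v :=
  have : FiniteDimensional ℝ (TangentSpace 𝓘(ℝ, E) v.proj) := inferInstanceAs (FiniteDimensional ℝ E)
  have : FiniteDimensional ℝ (TangentSpace 𝓘(ℝ, E).tangent v) :=
    inferInstanceAs (FiniteDimensional ℝ (E × E))
  LinearMap.linearEquivOfInjective
    (LinearMap.coprod (hlift cov v).toLinearMap (vlift v).toLinearMap)
    (by
      rw [injective_iff_map_eq_zero]
      rintro ⟨a, b⟩ h
      have h1 : hlift cov v a + vlift v b = 0 := h
      have h2 : a = 0 := by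
        have h3 := congrArg (mfderiv 𝓘(ℝ, E).tangent 𝓘(ℝ, E)
          (Bundle.TotalSpace.proj : TangentBundle 𝓘(ℝ, E) Q → Q) v) h1
        rw [map_add, proj_hlift, proj_vlift, map_zero] at h3
        exact (add_zero a).symm.trans h3
      subst h2
      rw [map_zero, zero_add] at h1
      have h4 : b = 0 := vlift_injective v (h1.trans (map_zero _).symm)
      rw [h4]
      rfl)
    (Module.finrank_prod (R := ℝ) (M := E) (M' := E) ▸ rfl)

@[simp]
lemma splitting_apply (cov : CovariantDerivative 𝓘(ℝ, E) E (TangentSpace 𝓘(ℝ, E) : Q → Type _))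
    (v : TangentBundle 𝓘(ℝ, E) Q) (a b : TangentSpace 𝓘(ℝ, E) v.proj) :
    splitting cov v (a, b) = hlift cov v a + vlift v b := rfl

end Connection

end AffineSpray

end

/-! Existence. Let `F` be the intersection of all families of subspaces, analytic or not, that
contain the vertical lift of `D` and are invariant under `Z`. A section of `F` is a section of every
such family, so `F` is invariant. The values of analytic sections of `F` form a subfamily that still
contains the vertical lift, because `D` is analytic, and is still invariant, because brackets with
the analytic field `Z` are analytic. By minimality it is all of `F`, so `F` is analytic and is the
smallest distribution sought.

Lower bound (`map_splitting_le_invariantHull`). For a section `Y` of `D`, `[Z, vlft Y] = vlft (∇_v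
Y) - hlft Y`, and `∇_v Y` lies in `D`; hence `F` contains the horizontal lift of `D` as well.

Upper bound (`isInvariantUnder_splitDist`). Take the family equal to `D ⊕ D` over points `v ∈ D` and
to the whole tangent space elsewhere. It contains the vertical lift, so only its invariance at `v ∈
D` is at stake. If `ξ` has horizontal and vertical components `a`, `β`, then `[Z, ξ]` has components
`∇_Z a - β + T(a, v)` and `∇_Z β + R(a, v) v`, where `∇_Z` is the covariant derivative along the
spray. The torsion term is in `D` by hypothesis, the curvature term by `curvature_mem`, and the
`∇_Z` terms by `modelCov_along_spray_mem`. The rank of `D` may vary, so no frames are used, only one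
local section through a given vector.

The computations are done in coordinates (`lieBracket_modelSpray_mem`) and transported through the
charts of `Q` and the induced charts of `TQ`. -/

noncomputable section

namespace AffineSpray

/-! ### Sprays, curvature and brackets in a vector space. -/

section Euclidean

open Filter VectorField

variable {E : Type*} [NormedAddCommGroup E] [NormedSpace ℝ E]

/-- The geodesic spray in coordinates, for the Christoffel symbols `G`. -/
def modelSpray (G : E → E →L[ℝ] E →L[ℝ] E) (p : E × E) : E × E := (p.2, -G p.1 p.2 p.2)

/-- `∇_u Y` at `y` in coordinates, for the Christoffel symbols `G`. -/
def modelCov (G : E → E →L[ℝ] E →L[ℝ] E) (Y : E → E) (y u : E) : E :=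
  fderiv ℝ Y y u + G y u (Y y)

/-- `Y` is near `y` an analytic section of `D`. -/
def IsSectionNear (D : E → Submodule ℝ E) (Y : E → E) (y : E) : Prop :=
  ContDiffAt ℝ ω Y y ∧ ∀ᶠ z in 𝓝 y, Y z ∈ D z

-- The product rule for `Γ(f, g)` along a map `y`. This generality serves the spray, the curvature
-- and the vertical component of a field on `TQ` alike.
set_option synthInstance.maxHeartbeats 100000 in
lemma hasFDerivAt_christoffel {G : E → E →L[ℝ] E →L[ℝ] E} {F : Type*} [NormedAddCommGroup F]
    [NormedSpace ℝ F] {y f g : F → E} {x : F} {y' f' g' : F →L[ℝ] E}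
    (hG : DifferentiableAt ℝ G (y x))
    (hy : HasFDerivAt y y' x) (hf : HasFDerivAt f f' x) (hg : HasFDerivAt g g' x) (u : F) :
    DifferentiableAt ℝ (fun z => G (y z) (f z) (g z)) x ∧
    fderiv ℝ (fun z => G (y z) (f z) (g z)) x u =
      fderiv ℝ G (y x) (y' u) (f x) (g x) + G (y x) (f' u) (g x) + G (y x) (f x) (g' u) := by
  have hG' := hG.hasFDerivAt
  have h0 := HasFDerivAt.comp (𝕜 := ℝ) (G := E →L[ℝ] E →L[ℝ] E) (g := G)
    (g' := fderiv ℝ G (y x)) x hG' hy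
  have h := (h0.clm_apply hf).clm_apply hg
  refine ⟨h.differentiableAt, ?_⟩
  have h2 := h.fderiv
  simp only [Function.comp_apply] at h2
  rw [h2]
  simp
  abel

lemma contDiffAt_modelSpray {G : E → E →L[ℝ] E →L[ℝ] E} {p : E × E}
    (hG : ContDiffAt ℝ ω G p.1) : ContDiffAt ℝ ω (modelSpray G) p := by
  have hG' : ContDiffAt ℝ ω (fun p : E × E => G p.1) p := hG.comp p contDiffAt_fst
  exact contDiffAt_snd.prodMk ((hG'.clm_apply contDiffAt_snd).clm_apply contDiffAt_snd).neg

lemma lieBracket_modelSpray {G : E → E →L[ℝ] E →L[ℝ] E} {y v : E} {a b : E × E → E}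
    (hG : DifferentiableAt ℝ G y) (ha : DifferentiableAt ℝ a (y, v))
    (hb : DifferentiableAt ℝ b (y, v)) :
    lieBracket ℝ (modelSpray G) (fun p => (a p, b p)) (y, v) =
      (fderiv ℝ a (y, v) (v, -G y v v) - b (y, v),
        fderiv ℝ b (y, v) (v, -G y v v) + fderiv ℝ G y (a (y, v)) v v
          + G y (b (y, v)) v + G y v (b (y, v))) := by
  have h1 := fun u => hasFDerivAt_christoffel (G := G) (x := (y, v)) (y := Prod.fst) (f := Prod.snd)
    (g := Prod.snd) hG hasFDerivAt_fst hasFDerivAt_snd hasFDerivAt_snd u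
  have h2 := (h1 0).1
  have h3 : fderiv ℝ (modelSpray G) (y, v) = (ContinuousLinearMap.snd ℝ E E).prod
      (-fderiv ℝ (fun p : E × E => G p.1 p.2 p.2) (y, v)) :=
    (hasFDerivAt_snd.prodMk h2.hasFDerivAt.neg).fderiv
  rw [lieBracket, h3, (ha.hasFDerivAt.prodMk hb.hasFDerivAt).fderiv]
  have h4 := (h1 (a (y, v), b (y, v))).2
  simp only [ContinuousLinearMap.coe_fst', ContinuousLinearMap.coe_snd'] at h4
  ext
  · simp [modelSpray]
  · simp [modelSpray, h4]
    abel

variable {D : E → Submodule ℝ E} {G : E → E →L[ℝ] E →L[ℝ] E}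

lemma modelCov_contDiffAt {Y : E → E} {y : E} (hG : ContDiffAt ℝ ω G y) (hY : ContDiffAt ℝ ω Y y)
    (u : E) : ContDiffAt ℝ ω (fun z => modelCov G Y z u) y :=
  ((hY.fderiv_right (m := ω) (by simp)).clm_apply contDiffAt_const).add
    ((hG.clm_apply contDiffAt_const).clm_apply hY)

/-- Being a section near a point is an open condition, so the restriction property applies at all
nearby points. This allows a second covariant derivative to be taken. -/
lemma IsSectionNear.modelCov {Y : E → E} {y : E} (hG : ContDiffAt ℝ ω G y)
    (hres : ∀ᶠ z in 𝓝 y, ∀ Y, IsSectionNear D Y z → ∀ u, modelCov G Y z u ∈ D z)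
    (hY : IsSectionNear D Y y) (u : E) : IsSectionNear D (fun z => modelCov G Y z u) y := by
  refine ⟨modelCov_contDiffAt hG hY.1 u, ?_⟩
  filter_upwards [hres, hY.1.eventually (by simp), hY.2.eventually_nhds] with z h1 h2 h3
  exact h1 Y ⟨h2, h3⟩ u

/-- The expression is the curvature `R(a, u) Y = ∇_a ∇_u Y - ∇_u ∇_a Y` for constant fields `a`,
`u`. Both terms lie in `D`, and the second derivatives of `Y` cancel by symmetry. -/
lemma curvature_mem {y : E} (hG : ContDiffAt ℝ ω G y)
    (hres : ∀ᶠ z in 𝓝 y, ∀ Y, IsSectionNear D Y z → ∀ u, modelCov G Y z u ∈ D z)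
    {Y : E → E} (hY : IsSectionNear D Y y) (a u : E) :
    fderiv ℝ G y a u (Y y) - fderiv ℝ G y u a (Y y) + G y a (G y u (Y y)) - G y u (G y a (Y y))
      ∈ D y := by
  have hGd : DifferentiableAt ℝ G y := hG.differentiableAt (by simp)
  have hYd : DifferentiableAt ℝ Y y := hY.1.differentiableAt (by simp)
  have hY' : DifferentiableAt ℝ (fderiv ℝ Y) y :=
    (hY.1.fderiv_right (m := ω) (by simp)).differentiableAt (by simp)
  have key (u a : E) : fderiv ℝ (fderiv ℝ Y) y a u + (fderiv ℝ G y a u (Y y)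
      + G y u (fderiv ℝ Y y a)) + G y a (fderiv ℝ Y y u + G y u (Y y)) ∈ D y := by
    have h := hres.self_of_nhds _ (hY.modelCov hG hres u) a
    have h1 : HasFDerivAt (fun z => fderiv ℝ Y z u) _ y :=
      hY'.hasFDerivAt.clm_apply (hasFDerivAt_const u y)
    have h2 := hasFDerivAt_christoffel (y := id) (f := fun _ => u) (g := Y) hGd (hasFDerivAt_id y)
      (hasFDerivAt_const u y) hYd.hasFDerivAt a
    have h3 : fderiv ℝ (fun z => AffineSpray.modelCov G Y z u) y =
      _ := (h1.add h2.1.hasFDerivAt).fderiv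
    have h4 := h2.2
    simp only [id_eq, ContinuousLinearMap.coe_id', zero_apply, map_zero, add_zero] at h4
    rw [AffineSpray.modelCov, h3] at h
    rw [← h4]
    simpa [AffineSpray.modelCov] using! h
  have hsymm : fderiv ℝ (fderiv ℝ Y) y a u = fderiv ℝ (fderiv ℝ Y) y u a :=
    (hY.1.isSymmSndFDerivAt (by simp)) a u
  convert (D y).sub_mem (key u a) (key a u) using 1
  rw [hsymm, map_add, map_add]
  abel

variable [FiniteDimensional ℝ E]

/-- The difference quotients along the line lie in `S`, which is closed because `E` is
finite-dimensional. -/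
lemma fderiv_apply_mem_of_line {F : Type*} [NormedAddCommGroup F] [NormedSpace ℝ F]
    {f : F → E} {S : Submodule ℝ E} {p w : F} (hf : DifferentiableAt ℝ f p)
    (h : ∀ᶠ t : ℝ in 𝓝 0, f (p + t • w) ∈ S) : fderiv ℝ f p w ∈ S := by
  have h1 : HasDerivAt (fun t : ℝ => f (p + t • w)) (fderiv ℝ f p w) 0 := by
    have := hf.hasFDerivAt.hasLineDerivAt w
    exact this
  have h0 : f p ∈ S := by simpa using h.self_of_nhds
  rw [hasDerivAt_iff_tendsto_slope] at h1
  refine S.closed_of_finiteDimensional.mem_of_tendsto h1 ?_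
  filter_upwards [h.filter_mono nhdsWithin_le_nhds] with t ht
  simp only [slope_def_module]
  refine S.smul_mem _ (S.sub_mem ht ?_)
  simpa using h0

/-- Pulling `f` back along a section `Y` of `D` through `v` gives a section of `D`, whose derivative
`∇_v` lies in `D`. The graph of `Y` has velocity `(v, DY v)` instead of the spray's `(v, -Γ(v, v))`;
the discrepancy is the fibre vector `∇_v Y`, which lies in `D`, and `f` keeps its values in `D y`
when moved along it. -/
lemma modelCov_along_spray_mem {y v : E} {f : E × E → E}
    (hres : ∀ Y, IsSectionNear D Y y → ∀ u, modelCov G Y y u ∈ D y)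
    {Y : E → E} (hY : IsSectionNear D Y y) (hv : Y y = v)
    (hf : ContDiffAt ℝ ω f (y, v)) (hfD : ∀ᶠ p in 𝓝 (y, v), p.2 ∈ D p.1 → f p ∈ D p.1) :
    fderiv ℝ f (y, v) (v, -G y v v) + G y v (f (y, v)) ∈ D y := by
  subst hv
  have hYd : DifferentiableAt ℝ Y y := hY.1.differentiableAt (by simp)
  have hfd : DifferentiableAt ℝ f (y, Y y) := hf.differentiableAt (by simp)
  have hgc : ContDiffAt ℝ ω (fun z => (z, Y z)) y := contDiffAt_id.prodMk hY.1
  have hA : IsSectionNear D (fun z => f (z, Y z)) y := by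
    refine ⟨ContDiffAt.comp y hf hgc, ?_⟩
    filter_upwards [hgc.continuousAt.eventually hfD, hY.2] with z h1 h2
    exact h1 h2
  have h1 := hres _ hA (Y y)
  have h2 : fderiv ℝ (fun z => f (z, Y z)) y = _ :=
    (HasFDerivAt.comp y hfd.hasFDerivAt ((hasFDerivAt_id y).prodMk hYd.hasFDerivAt)).fderiv
  rw [modelCov, h2] at h1
  have h3 := hres Y hY (Y y)
  -- The line `(y, v + t ∇_v Y)` stays in the fibre `D y`, so the hypothesis on `f` applies along
  -- it.
  have h4 : fderiv ℝ f (y, Y y) (0, modelCov G Y y (Y y)) ∈ D y := by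
    refine fderiv_apply_mem_of_line hfd ?_
    have hc : Tendsto (fun t : ℝ => (y, Y y) + t • ((0 : E), modelCov G Y y (Y y))) (𝓝 0)
        (𝓝 (y, Y y)) := by
      have : Continuous (fun t : ℝ => (y, Y y) + t • ((0 : E), modelCov G Y y (Y y))) := by
        fun_prop
      simpa using this.tendsto 0
    filter_upwards [hc.eventually hfD] with t ht
    simp only [Prod.mk_add_mk, Prod.smul_mk, smul_zero, add_zero] at ht ⊢
    exact ht ((D y).add_mem hY.2.self_of_nhds ((D y).smul_mem _ h3))
  convert (D y).sub_mem h1 h4 using 1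
  have h5 : (Y y, -G y (Y y) (Y y)) = (Y y, fderiv ℝ Y y (Y y)) - (0, modelCov G Y y (Y y)) := by
    ext <;> simp [modelCov]
  rw [h5, map_sub]
  simp
  abel

/-- The bracket of the spray with a field whose horizontal and vertical components are in `D` along
`D` has the same property. -/
lemma lieBracket_modelSpray_mem {y v : E} (hG : ContDiffAt ℝ ω G y)
    (hres : ∀ᶠ z in 𝓝 y, ∀ Y, IsSectionNear D Y z → ∀ u, modelCov G Y z u ∈ D z)
    (hsec : ∀ u ∈ D y, ∃ Y, IsSectionNear D Y y ∧ Y y = u)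
    (htor : ∀ u ∈ D y, ∀ w ∈ D y, G y u w - G y w u ∈ D y)
    (hv : v ∈ D y) {ξ : E × E → E × E} (hξ : ContDiffAt ℝ ω ξ (y, v))
    (hξD : ∀ᶠ p in 𝓝 (y, v), p.2 ∈ D p.1 →
      (ξ p).1 ∈ D p.1 ∧ (ξ p).2 + G p.1 (ξ p).1 p.2 ∈ D p.1) :
    (lieBracket ℝ (modelSpray G) ξ (y, v)).1 ∈ D y ∧
      (lieBracket ℝ (modelSpray G) ξ (y, v)).2 +
        G y (lieBracket ℝ (modelSpray G) ξ (y, v)).1 v ∈ D y := by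
  obtain ⟨Y, hY, hYv⟩ := hsec v hv
  have hGd : DifferentiableAt ℝ G y := hG.differentiableAt (by simp)
  have ha : ContDiffAt ℝ ω (fun p => (ξ p).1) (y, v) := contDiffAt_fst.comp _ hξ
  have hb : ContDiffAt ℝ ω (fun p => (ξ p).2) (y, v) := contDiffAt_snd.comp _ hξ
  have had : DifferentiableAt ℝ (fun p => (ξ p).1) (y, v) := ha.differentiableAt (by simp)
  have hbd : DifferentiableAt ℝ (fun p => (ξ p).2) (y, v) := hb.differentiableAt (by simp)
  have hGf : ContDiffAt ℝ ω (fun p : E × E => G p.1) (y, v) := hG.comp (y, v) contDiffAt_fst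
  -- The coordinate expression of the vertical component `β` of `ξ`.
  have hβ : ContDiffAt ℝ ω (fun p => (ξ p).2 + G p.1 (ξ p).1 p.2) (y, v) :=
    hb.add ((hGf.clm_apply ha).clm_apply contDiffAt_snd)
  have hres' := hres.self_of_nhds
  have m1 := modelCov_along_spray_mem hres' hY hYv ha (hξD.mono fun p h hp => (h hp).1)
  have m2 := modelCov_along_spray_mem hres' hY hYv hβ (hξD.mono fun p h hp => (h hp).2)
  have hc := hasFDerivAt_christoffel (G := G) (x := (y, v)) (y := Prod.fst)
    (f := fun p => (ξ p).1) (g := Prod.snd) hGd hasFDerivAt_fst had.hasFDerivAt hasFDerivAt_snd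
    (v, -G y v v)
  rw [fderiv_fun_add hbd hc.1, add_apply, hc.2] at m2
  have m3 := curvature_mem hG hres hY (ξ (y, v)).1 v
  rw [hYv] at m3
  obtain ⟨m4, m5⟩ := hξD.self_of_nhds hv
  have hbr : lieBracket ℝ (modelSpray G) ξ (y, v) = _ := lieBracket_modelSpray hGd had hbd
  rw [hbr]
  simp only at m1 m2 m3 m4 m5 ⊢
  constructor
  -- Horizontal component: `∇_Z a - β + T(a, v)`.
  · convert (D y).add_mem ((D y).sub_mem m1 m5) (htor _ m4 _ hv) using 1
    abel
  -- Vertical component: `∇_Z β + R(a, v) v`.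
  · convert (D y).add_mem m2 m3 using 1
    simp
    abel

end Euclidean

/-! ### Vector fields and their brackets in a chart. -/

section CoordRep

open Filter VectorField Set

variable {E : Type*} [NormedAddCommGroup E] [NormedSpace ℝ E]
  {H : Type*} [TopologicalSpace H] {I : ModelWithCorners ℝ E H}
  {M : Type*} [TopologicalSpace M] [ChartedSpace H M]

variable (I) in
/-- The derivative at `x` of the chart at `x₀`: the components of tangent vectors at `x` in this
chart. -/
def chartDeriv (x₀ x : M) : TangentSpace I x →L[ℝ] E :=
  mfderiv I 𝓘(ℝ, E) (extChartAt I x₀) x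

variable (I) in
/-- The components of the vector field `X` in the chart at `x₀`, as a function on the model
space. -/
def coordRep (x₀ : M) (X : ∀ x : M, TangentSpace I x) (y : E) : E :=
  chartDeriv I x₀ ((extChartAt I x₀).symm y) (X ((extChartAt I x₀).symm y))

variable {x₀ x : M} {X V W : ∀ x : M, TangentSpace I x}

lemma coordRep_apply (hx : x ∈ (extChartAt I x₀).source) :
    coordRep I x₀ X (extChartAt I x₀ x) = chartDeriv I x₀ x (X x) := by
  simp only [coordRep]
  rw [(extChartAt I x₀).left_inv hx]

lemma chartDeriv_self_apply [IsManifold I 1 M] (u : TangentSpace I x₀) :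
    chartDeriv I x₀ x₀ u = u :=
  DFunLike.congr_fun (mfderiv_extChartAt_self (I := I) (x := x₀)) u

lemma trivializationAt_snd [IsManifold I 1 M] (hx : x ∈ (extChartAt I x₀).source)
    (u : TangentSpace I x) :
    (trivializationAt E (TangentSpace I) x₀ ⟨x, u⟩).2 =
      chartDeriv I x₀ x u := by
  rw [extChartAt_source] at hx
  have h1 : (trivializationAt E (TangentSpace I) x₀).continuousLinearMapAt ℝ x u =
      (trivializationAt E (TangentSpace I) x₀ ⟨x, u⟩).2 := by
    rw [Bundle.Trivialization.continuousLinearMapAt_apply,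
      Bundle.Trivialization.coe_linearMapAt_of_mem _ hx]
  exact h1.symm.trans (DFunLike.congr_fun
    (TangentBundle.continuousLinearMapAt_trivializationAt (I := I) hx) u)

lemma trivializationAt_snd_eventuallyEq [IsManifold I 1 M] (hx : x ∈ (extChartAt I x₀).source) :
    (fun x => (trivializationAt E (TangentSpace I) x₀ ⟨x, X x⟩).2) =ᶠ[𝓝 x]
      coordRep I x₀ X ∘ extChartAt I x₀ := by
  filter_upwards [(isOpen_extChartAt_source x₀).mem_nhds hx] with z hz
  rw [trivializationAt_snd hz, Function.comp_apply, coordRep_apply hz]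

lemma mpullbackWithin_eq_coordRep [IsManifold I 1 M] {y : E} (hy : y ∈ (extChartAt I x₀).target) :
    mpullbackWithin 𝓘(ℝ, E) I (extChartAt I x₀).symm X (range I) y = coordRep I x₀ X y := by
  rw [mpullbackWithin_apply, coordRep, ContinuousLinearMap.inverse_eq
    (mfderivWithin_extChartAt_symm_comp_mfderiv_extChartAt hy)
    (mfderiv_extChartAt_comp_mfderivWithin_extChartAt_symm hy)]
  rfl

variable [I.Boundaryless]

lemma coordRep_eventuallyEq [IsManifold I 1 M] (hx : x ∈ (extChartAt I x₀).source) :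
    (fun x => (trivializationAt E (TangentSpace I) x₀ ⟨x, X x⟩).2) ∘ (extChartAt I x₀).symm
      =ᶠ[𝓝 (extChartAt I x₀ x)] coordRep I x₀ X := by
  filter_upwards [extChartAt_target_mem_nhds' ((extChartAt I x₀).map_source hx)] with z hz
  rw [Function.comp_apply, trivializationAt_snd ((extChartAt I x₀).map_target hz)]
  rfl

lemma contMDiffAt_iff_coordRep [IsManifold I ω M] (hx : x ∈ (extChartAt I x₀).source) :
    haveI : IsManifold I 1 M := .of_le (n := ω) le_top
    ContMDiffAt I I.tangent ω (fun x => (⟨x, X x⟩ : TangentBundle I M)) x ↔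
      ContDiffAt ℝ ω (coordRep I x₀ X) (extChartAt I x₀ x) := by
  have : IsManifold I 1 M := .of_le (n := ω) le_top
  have hx' : x ∈ (trivializationAt E (TangentSpace I) x₀).baseSet := by
    rwa [TangentBundle.trivializationAt_baseSet, ← extChartAt_source I]
  have h := Bundle.Trivialization.contMDiffAt_section_iff (n := ω) (IB := I) (s := X)
    (trivializationAt E (TangentSpace I) x₀) hx'
  refine h.trans ⟨fun h1 => ?_, fun h1 => ?_⟩
  · have h2 := contMDiffOn_extChartAt_symm (I := I) (n := ω) x₀
    have h3 := h2.contMDiffAt (extChartAt_target_mem_nhds' ((extChartAt I x₀).map_source hx))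
    have h4 := ContMDiffAt.comp_of_eq h1 h3 ((extChartAt I x₀).left_inv hx)
    exact h4.contDiffAt.congr_of_eventuallyEq (coordRep_eventuallyEq hx).symm
  · have h2 := h1.contMDiffAt.comp x
      (contMDiffAt_extChartAt' (I := I) (by rwa [← extChartAt_source I]))
    exact h2.congr_of_eventuallyEq (trivializationAt_snd_eventuallyEq hx)

lemma differentiableAt_coordRep [IsManifold I ω M] (hx : x ∈ (extChartAt I x₀).source)
    (hX : haveI : IsManifold I 1 M := .of_le (n := ω) le_top
      MDifferentiableAt I I.tangent (fun x => (⟨x, X x⟩ : TangentBundle I M)) x) :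
    DifferentiableAt ℝ (coordRep I x₀ X) (extChartAt I x₀ x) := by
  have : IsManifold I 1 M := .of_le (n := ω) le_top
  have hx' : x ∈ (trivializationAt E (TangentSpace I) x₀).baseSet := by
    rwa [TangentBundle.trivializationAt_baseSet, ← extChartAt_source I]
  have h1 := (Bundle.Trivialization.mdifferentiableAt_section_iff I
    (trivializationAt E (TangentSpace I) x₀) X hx').1 hX
  have h2 := contMDiffOn_extChartAt_symm (I := I) (n := ω) x₀
  have h3 := (h2.contMDiffAt (extChartAt_target_mem_nhds'
    ((extChartAt I x₀).map_source hx))).mdifferentiableAt (by simp)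
  have h4 := MDifferentiableAt.comp_of_eq (x := extChartAt I x₀ x) h1 h3
    ((extChartAt I x₀).left_inv hx)
  exact h4.differentiableAt.congr_of_eventuallyEq (coordRep_eventuallyEq hx).symm

/-- The manifold bracket at `x₀` is by definition the bracket of the pullbacks to the chart at `x₀`,
and these agree with `coordRep` near the point. The derivative of this chart at its own centre is
the identity. -/
lemma chartDeriv_mlieBracket [IsManifold I 1 M] :
    chartDeriv I x₀ x₀ (mlieBracket I V W x₀) =
      lieBracket ℝ (coordRep I x₀ V) (coordRep I x₀ W) (extChartAt I x₀ x₀) := by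
  have h (X : ∀ x : M, TangentSpace I x) :
      mpullbackWithin 𝓘(ℝ, E) I (extChartAt I x₀).symm X (range I)
        =ᶠ[𝓝 (extChartAt I x₀ x₀)] coordRep I x₀ X := by
    filter_upwards [extChartAt_target_mem_nhds (I := I) x₀] with z hz
    exact mpullbackWithin_eq_coordRep hz
  have h1 : (mfderiv I 𝓘(ℝ, E) (extChartAt I x₀) x₀).inverse = ContinuousLinearMap.id ℝ E :=
    (congrArg (fun f : E →L[ℝ] E => f.inverse) (mfderiv_extChartAt_self (I := I))).trans
      ContinuousLinearMap.inverse_id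
  have h2 : (extChartAt I x₀).symm ⁻¹' univ ∩ range I = univ := by
    rw [preimage_univ, univ_inter, I.range_eq_univ]
  have h3 : lieBracketWithin ℝ
      (mpullbackWithin 𝓘(ℝ, E) I (extChartAt I x₀).symm V (range I))
      (mpullbackWithin 𝓘(ℝ, E) I (extChartAt I x₀).symm W (range I))
      ((extChartAt I x₀).symm ⁻¹' univ ∩ range I) (extChartAt I x₀ x₀) =
      lieBracket ℝ (coordRep I x₀ V) (coordRep I x₀ W) (extChartAt I x₀ x₀) := by
    rw [h2]
    exact (congrFun lieBracketWithin_univ _).trans ((h V).lieBracket_vectorField_eq (h W))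
  exact (chartDeriv_self_apply _).trans ((DFunLike.congr_fun h1 _).trans h3)

end CoordRep

/-! ### Fields with constant components in a chart. -/

section ConstField

open Filter VectorField Set

variable {E : Type*} [NormedAddCommGroup E] [NormedSpace ℝ E]
  {H : Type*} [TopologicalSpace H] {I : ModelWithCorners ℝ E H}
  {M : Type*} [TopologicalSpace M] [ChartedSpace H M] {x₀ x : M}

lemma chartDeriv_injective [IsManifold I 1 M] (hx : x ∈ (extChartAt I x₀).source) :
    Function.Injective (chartDeriv I x₀ x) :=
  (isInvertible_mfderiv_extChartAt hx).bijective.1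

variable (I) in
/-- The vector field on the chart domain at `x₀` with constant components `w`. -/
def constField [IsManifold I 1 M] (x₀ : M) (w : E) (x : M) : TangentSpace I x :=
  (trivializationAt E (TangentSpace I) x₀).symmL ℝ x w

lemma chartDeriv_constField [IsManifold I 1 M] (hx : x ∈ (extChartAt I x₀).source) (w : E) :
    chartDeriv I x₀ x (constField I x₀ w x) = w := by
  have hx' : x ∈ (trivializationAt E (TangentSpace I) x₀).baseSet := by
    rwa [TangentBundle.trivializationAt_baseSet, ← extChartAt_source I]
  rw [← trivializationAt_snd hx, constField, Bundle.Trivialization.symmL_apply,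
    Bundle.Trivialization.apply_mk_symm _ hx']
  exact hx'

lemma constField_chartDeriv [IsManifold I 1 M] (hx : x ∈ (extChartAt I x₀).source)
    (u : TangentSpace I x) : constField I x₀ (chartDeriv I x₀ x u) x = u :=
  chartDeriv_injective hx (chartDeriv_constField hx _)

lemma coordRep_constField [IsManifold I 1 M] {y : E} (hy : y ∈ (extChartAt I x₀).target) (w : E) :
    coordRep I x₀ (constField I x₀ w) y = w :=
  chartDeriv_constField ((extChartAt I x₀).map_target hy) w

variable [I.Boundaryless]

lemma coordRep_constField_eventuallyEq [IsManifold I 1 M]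
    (hx : x ∈ (extChartAt I x₀).source) (w : E) :
    coordRep I x₀ (constField I x₀ w) =ᶠ[𝓝 (extChartAt I x₀ x)] fun _ => w := by
  filter_upwards [extChartAt_target_mem_nhds' ((extChartAt I x₀).map_source hx)] with y hy
  exact coordRep_constField hy w

lemma contMDiffAt_constField [IsManifold I ω M] (hx : x ∈ (extChartAt I x₀).source) (w : E) :
    haveI : IsManifold I 1 M := .of_le (n := ω) le_top
    ContMDiffAt I I.tangent ω (fun x => (⟨x, constField I x₀ w x⟩ : TangentBundle I M)) x := by
  have : IsManifold I 1 M := .of_le (n := ω) le_top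
  exact (contMDiffAt_iff_coordRep hx).2
    (contDiffAt_const.congr_of_eventuallyEq (coordRep_constField_eventuallyEq hx w))

lemma mlieBracket_constField [IsManifold I 1 M] (u w : E) :
    mlieBracket I (constField I x₀ u) (constField I x₀ w) x₀ = 0 := by
  apply chartDeriv_injective (mem_extChartAt_source x₀)
  rw [chartDeriv_mlieBracket, map_zero]
  have h := fun w => coordRep_constField_eventuallyEq (I := I) (mem_extChartAt_source x₀) w
  rw [(h u).lieBracket_vectorField_eq (h w)]
  simp [lieBracket]

end ConstField

/-! ### Christoffel symbols. -/

section Christoffel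

open Filter VectorField Set

variable {E : Type*} [NormedAddCommGroup E] [NormedSpace ℝ E]
  {Q : Type*} [TopologicalSpace Q] [ChartedSpace E Q] [IsManifold 𝓘(ℝ, E) ω Q]

/-- The flat covariant derivative on the chart domain at `q₀`: differentiation of components. -/
def flatCov (q₀ : Q) (Y : ∀ q : Q, TangentSpace 𝓘(ℝ, E) q) (q : Q) :
    TangentSpace 𝓘(ℝ, E) q →L[ℝ] TangentSpace 𝓘(ℝ, E) q :=
  ((trivializationAt E (TangentSpace 𝓘(ℝ, E)) q₀).symmL ℝ q).comp
    ((fderiv ℝ (coordRep 𝓘(ℝ, E) q₀ Y) (extChartAt 𝓘(ℝ, E) q₀ q)).comp (chartDeriv 𝓘(ℝ, E) q₀ q))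

lemma flatCov_apply (q₀ : Q) (Y : ∀ q : Q, TangentSpace 𝓘(ℝ, E) q) (q : Q)
    (u : TangentSpace 𝓘(ℝ, E) q) :
    flatCov q₀ Y q u = constField 𝓘(ℝ, E) q₀ (fderiv ℝ (coordRep 𝓘(ℝ, E) q₀ Y)
      (extChartAt 𝓘(ℝ, E) q₀ q) (chartDeriv 𝓘(ℝ, E) q₀ q u)) q := rfl

lemma chartDeriv_flatCov {q₀ q : Q} (hq : q ∈ (extChartAt 𝓘(ℝ, E) q₀).source)
    (Y : ∀ q : Q, TangentSpace 𝓘(ℝ, E) q) (u : TangentSpace 𝓘(ℝ, E) q) :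
    chartDeriv 𝓘(ℝ, E) q₀ q (flatCov q₀ Y q u) = fderiv ℝ (coordRep 𝓘(ℝ, E) q₀ Y)
      (extChartAt 𝓘(ℝ, E) q₀ q) (chartDeriv 𝓘(ℝ, E) q₀ q u) := by
  rw [flatCov_apply, chartDeriv_constField hq]

/-- Two covariant derivatives differ by a tensor; comparison with this one produces the Christoffel
symbols. -/
lemma isCovariantDerivativeOn_flatCov (q₀ : Q) :
    IsCovariantDerivativeOn (I := 𝓘(ℝ, E)) E (flatCov q₀) (extChartAt 𝓘(ℝ, E) q₀).source where
  add {Y Y' q} hY hY' hq := by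
    ext1 u
    apply chartDeriv_injective hq
    have h1 : coordRep 𝓘(ℝ, E) q₀ (Y + Y') =
        coordRep 𝓘(ℝ, E) q₀ Y + coordRep 𝓘(ℝ, E) q₀ Y' := by
      funext y
      exact map_add (chartDeriv 𝓘(ℝ, E) q₀ _) _ _
    rw [add_apply, map_add, chartDeriv_flatCov hq, chartDeriv_flatCov hq, chartDeriv_flatCov hq,
      h1, fderiv_add (differentiableAt_coordRep hq hY) (differentiableAt_coordRep hq hY')]
    rfl
  leibniz {Y g q} hY hg hq := by
    ext1 u
    apply chartDeriv_injective hq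
    have hq' := hq
    rw [extChartAt_source] at hq'
    have h1 : coordRep 𝓘(ℝ, E) q₀ (g • Y) = fun y =>
        g ((extChartAt 𝓘(ℝ, E) q₀).symm y) • coordRep 𝓘(ℝ, E) q₀ Y y := by
      funext y
      exact map_smul (chartDeriv 𝓘(ℝ, E) q₀ _) _ _
    have h2 : DifferentiableAt ℝ (fun y => g ((extChartAt 𝓘(ℝ, E) q₀).symm y))
        (extChartAt 𝓘(ℝ, E) q₀ q) := by
      have h3 := ((contMDiffOn_extChartAt_symm (I := 𝓘(ℝ, E)) (n := ω) q₀).contMDiffAt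
        (extChartAt_target_mem_nhds' ((extChartAt 𝓘(ℝ, E) q₀).map_source hq))).mdifferentiableAt
          (by simp)
      exact (MDifferentiableAt.comp_of_eq (x := extChartAt 𝓘(ℝ, E) q₀ q) hg h3
        ((extChartAt 𝓘(ℝ, E) q₀).left_inv hq)).differentiableAt
    have h4 : fderiv ℝ (fun y => g ((extChartAt 𝓘(ℝ, E) q₀).symm y)) (extChartAt 𝓘(ℝ, E) q₀ q)
        (chartDeriv 𝓘(ℝ, E) q₀ q u) = mfderiv 𝓘(ℝ, E) 𝓘(ℝ, ℝ) g q u := by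
      have h5 := HasMFDerivAt.comp q h2.hasFDerivAt.hasMFDerivAt
        (mdifferentiableAt_extChartAt hq').hasMFDerivAt
      have h6 : g =ᶠ[𝓝 q] (fun y => g ((extChartAt 𝓘(ℝ, E) q₀).symm y)) ∘
          extChartAt 𝓘(ℝ, E) q₀ := by
        filter_upwards [(isOpen_extChartAt_source q₀).mem_nhds hq] with z hz
        rw [Function.comp_apply, (extChartAt 𝓘(ℝ, E) q₀).left_inv hz]
      exact (DFunLike.congr_fun (hasMFDerivAt_unique hg.hasMFDerivAt
        (h5.congr_of_eventuallyEq h6)) u).symm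
    have h7 : fderiv ℝ (coordRep 𝓘(ℝ, E) q₀ (g • Y)) (extChartAt 𝓘(ℝ, E) q₀ q)
        (chartDeriv 𝓘(ℝ, E) q₀ q u) = g q • fderiv ℝ (coordRep 𝓘(ℝ, E) q₀ Y)
          (extChartAt 𝓘(ℝ, E) q₀ q) (chartDeriv 𝓘(ℝ, E) q₀ q u) +
          (show ℝ from mfderiv 𝓘(ℝ, E) 𝓘(ℝ, ℝ) g q u) • chartDeriv 𝓘(ℝ, E) q₀ q (Y q) := by
      rw [h1, fderiv_fun_smul h2 (differentiableAt_coordRep hq hY), ← coordRep_apply hq,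
        (extChartAt 𝓘(ℝ, E) q₀).left_inv hq]
      exact congrArg (fun z : ℝ => (_ : E) + z • (_ : E)) h4
    rw [chartDeriv_flatCov hq, h7, ← chartDeriv_flatCov hq]
    exact ((map_add _ _ _).trans (congrArg₂ _ (map_smul _ _ _) (map_smul _ _ _))).symm

variable [FiniteDimensional ℝ E]

/-- The Christoffel symbols of the connection in the chart at `q₀`. -/
def christoffel (cov : CovariantDerivative 𝓘(ℝ, E) E (TangentSpace 𝓘(ℝ, E) : Q → Type _))
    (q₀ : Q) (y : E) : E →L[ℝ] E →L[ℝ] E :=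
  let q := (extChartAt 𝓘(ℝ, E) q₀).symm y
  let d : E →L[ℝ] E →L[ℝ] E := IsCovariantDerivativeOn.difference
    (cov.isCovariantDerivativeOn (s := (extChartAt 𝓘(ℝ, E) q₀).source))
    (isCovariantDerivativeOn_flatCov q₀) q
  let c : E →L[ℝ] E := (trivializationAt E (TangentSpace 𝓘(ℝ, E)) q₀).symmL ℝ q
  let l : E →L[ℝ] E := chartDeriv 𝓘(ℝ, E) q₀ q
  (ContinuousLinearMap.compL ℝ E E E l).comp (d.flip.bilinearComp c c)

lemma chartDeriv_cov (cov : CovariantDerivative 𝓘(ℝ, E) E (TangentSpace 𝓘(ℝ, E) : Q → Type _))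
    {q₀ q : Q} (hq : q ∈ (extChartAt 𝓘(ℝ, E) q₀).source) {Y : ∀ q : Q, TangentSpace 𝓘(ℝ, E) q}
    (hY : MDifferentiableAt 𝓘(ℝ, E) 𝓘(ℝ, E).tangent
      (fun x => (⟨x, Y x⟩ : TangentBundle 𝓘(ℝ, E) Q)) q) (u : TangentSpace 𝓘(ℝ, E) q) :
    chartDeriv 𝓘(ℝ, E) q₀ q (cov Y q u) =
      modelCov (christoffel cov q₀) (coordRep 𝓘(ℝ, E) q₀ Y) (extChartAt 𝓘(ℝ, E) q₀ q)
        (chartDeriv 𝓘(ℝ, E) q₀ q u) := by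
  have h1 := DFunLike.congr_fun (IsCovariantDerivativeOn.difference_apply
    (cov.isCovariantDerivativeOn (s := (extChartAt 𝓘(ℝ, E) q₀).source))
    (isCovariantDerivativeOn_flatCov q₀) hq hY) u
  have h2 : christoffel cov q₀ (extChartAt 𝓘(ℝ, E) q₀ q) (chartDeriv 𝓘(ℝ, E) q₀ q u)
      (coordRep 𝓘(ℝ, E) q₀ Y (extChartAt 𝓘(ℝ, E) q₀ q)) =
      chartDeriv 𝓘(ℝ, E) q₀ q (IsCovariantDerivativeOn.difference
    (cov.isCovariantDerivativeOn (s := (extChartAt 𝓘(ℝ, E) q₀).source))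
    (isCovariantDerivativeOn_flatCov q₀) q (Y q) u) := by
    -- Unfolded with the base point still in the form `symm (chart q)`, so that one rewrite replaces
    -- it in all dependent types at once.
    have h3 : christoffel cov q₀ (extChartAt 𝓘(ℝ, E) q₀ q) (chartDeriv 𝓘(ℝ, E) q₀ q u)
        (coordRep 𝓘(ℝ, E) q₀ Y (extChartAt 𝓘(ℝ, E) q₀ q)) =
        chartDeriv 𝓘(ℝ, E) q₀ _ (IsCovariantDerivativeOn.difference
          (cov.isCovariantDerivativeOn (s := (extChartAt 𝓘(ℝ, E) q₀).source))
          (isCovariantDerivativeOn_flatCov q₀) _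
          (constField 𝓘(ℝ, E) q₀ (coordRep 𝓘(ℝ, E) q₀ Y (extChartAt 𝓘(ℝ, E) q₀ q)) _)
          (constField 𝓘(ℝ, E) q₀ (chartDeriv 𝓘(ℝ, E) q₀ q u)
            ((extChartAt 𝓘(ℝ, E) q₀).symm (extChartAt 𝓘(ℝ, E) q₀ q)))) := rfl
    rw [h3, (extChartAt 𝓘(ℝ, E) q₀).left_inv hq, coordRep_apply hq, constField_chartDeriv hq,
      constField_chartDeriv hq]
  rw [modelCov, h2, h1, sub_apply, map_sub, chartDeriv_flatCov hq]
  abel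

end Christoffel

/-! ### Lifts, spray and splitting in the charts of the tangent bundle. -/

section TangentCoordinates

open Filter VectorField Set

variable {E : Type*} [NormedAddCommGroup E] [NormedSpace ℝ E]
  {Q : Type*} [TopologicalSpace Q] [ChartedSpace E Q] [IsManifold 𝓘(ℝ, E) ω Q]

lemma mem_extChartAt_tangent_source {v p : TangentBundle 𝓘(ℝ, E) Q} :
    p ∈ (extChartAt 𝓘(ℝ, E).tangent v).source ↔
      p.proj ∈ (extChartAt 𝓘(ℝ, E) v.proj).source := by
  rw [extChartAt_source, extChartAt_source]
  exact TangentBundle.mem_chart_source_iff p v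

lemma extChartAt_tangent_apply {v p : TangentBundle 𝓘(ℝ, E) Q}
    (hp : p.proj ∈ (extChartAt 𝓘(ℝ, E) v.proj).source) :
    extChartAt 𝓘(ℝ, E).tangent v p =
      (extChartAt 𝓘(ℝ, E) v.proj p.proj, chartDeriv 𝓘(ℝ, E) v.proj p.proj p.snd) := by
  rw [← trivializationAt_snd hp]
  rfl

lemma extChartAt_tangent_self (v : TangentBundle 𝓘(ℝ, E) Q) :
    extChartAt 𝓘(ℝ, E).tangent v v =
      (extChartAt 𝓘(ℝ, E) v.proj v.proj, chartDeriv 𝓘(ℝ, E) v.proj v.proj v.snd) :=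
  extChartAt_tangent_apply (mem_extChartAt_source v.proj)

lemma chartDeriv_vlift {v p : TangentBundle 𝓘(ℝ, E) Q}
    (hp : p.proj ∈ (extChartAt 𝓘(ℝ, E) v.proj).source) (w : TangentSpace 𝓘(ℝ, E) p.proj) :
    chartDeriv 𝓘(ℝ, E).tangent v p (vlift p w) = (0, chartDeriv 𝓘(ℝ, E) v.proj p.proj w) := by
  have hp' : p ∈ (chartAt (ModelProd E E) v).source := by
    rw [← extChartAt_source 𝓘(ℝ, E).tangent]
    exact mem_extChartAt_tangent_source.2 hp
  have h1 := HasMFDerivAt.comp (I := 𝓘(ℝ, E)) (f := fibreIncl (E := E) p.proj) (M := E) p.snd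
    (mdifferentiableAt_extChartAt hp').hasMFDerivAt
    (mdifferentiableAt_fibreIncl (E := E) p.proj p.snd).hasMFDerivAt
  let l : E →L[ℝ] E := chartDeriv 𝓘(ℝ, E) v.proj p.proj
  have h2 : HasFDerivAt (fun w : E => (extChartAt 𝓘(ℝ, E) v.proj p.proj, l w))
      ((0 : E →L[ℝ] E).prod l) p.snd := (hasFDerivAt_const _ _).prodMk l.hasFDerivAt
  have h3 : (extChartAt 𝓘(ℝ, E).tangent v) ∘ fibreIncl (E := E) p.proj =
      fun w : E => (extChartAt 𝓘(ℝ, E) v.proj p.proj, l w) := by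
    funext w
    exact extChartAt_tangent_apply (p := fibreIncl p.proj w) hp
  rw [h3] at h1
  exact DFunLike.congr_fun (hasMFDerivAt_unique h1 h2.hasMFDerivAt) w

lemma chartDeriv_mfderiv_section {v : TangentBundle 𝓘(ℝ, E) Q} {q : Q}
    (hq : q ∈ (extChartAt 𝓘(ℝ, E) v.proj).source) {Y : ∀ q : Q, TangentSpace 𝓘(ℝ, E) q}
    (hY : MDifferentiableAt 𝓘(ℝ, E) 𝓘(ℝ, E).tangent
      (fun x => (⟨x, Y x⟩ : TangentBundle 𝓘(ℝ, E) Q)) q) (u : TangentSpace 𝓘(ℝ, E) q) :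
    chartDeriv 𝓘(ℝ, E).tangent v ⟨q, Y q⟩ (mfderiv 𝓘(ℝ, E) 𝓘(ℝ, E).tangent
      (fun x => (⟨x, Y x⟩ : TangentBundle 𝓘(ℝ, E) Q)) q u) =
      (chartDeriv 𝓘(ℝ, E) v.proj q u, fderiv ℝ (coordRep 𝓘(ℝ, E) v.proj Y)
        (extChartAt 𝓘(ℝ, E) v.proj q) (chartDeriv 𝓘(ℝ, E) v.proj q u)) := by
  have hp' : (⟨q, Y q⟩ : TangentBundle 𝓘(ℝ, E) Q) ∈ (chartAt (ModelProd E E) v).source := by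
    rw [← extChartAt_source 𝓘(ℝ, E).tangent]
    exact mem_extChartAt_tangent_source.2 hq
  have hq' := hq
  rw [extChartAt_source] at hq'
  have h1 := HasMFDerivAt.comp (I := 𝓘(ℝ, E)) q
    (mdifferentiableAt_extChartAt (I := 𝓘(ℝ, E).tangent) hp').hasMFDerivAt hY.hasMFDerivAt
  have h2 := (hasFDerivAt_id (𝕜 := ℝ) (extChartAt 𝓘(ℝ, E) v.proj q)).prodMk
    (differentiableAt_coordRep hq hY).hasFDerivAt
  have h3 := HasMFDerivAt.comp q h2.hasMFDerivAt (mdifferentiableAt_extChartAt hq').hasMFDerivAt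
  have h4 : (extChartAt 𝓘(ℝ, E).tangent v) ∘ (fun x => (⟨x, Y x⟩ : TangentBundle 𝓘(ℝ, E) Q))
      =ᶠ[𝓝 q] (fun y => (id y, coordRep 𝓘(ℝ, E) v.proj Y y)) ∘ extChartAt 𝓘(ℝ, E) v.proj := by
    filter_upwards [(isOpen_extChartAt_source v.proj).mem_nhds hq] with z hz
    rw [Function.comp_apply, Function.comp_apply, extChartAt_tangent_apply hz, coordRep_apply hz]
    rfl
  exact DFunLike.congr_fun (hasMFDerivAt_unique h1 (h3.congr_of_eventuallyEq h4)) u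

variable [FiniteDimensional ℝ E]
  (cov : CovariantDerivative 𝓘(ℝ, E) E (TangentSpace 𝓘(ℝ, E) : Q → Type _))

/-- With `σ` the extension of `p` used in `hlift`, the derivative of `σ` contributes `(u, Dσ u)` and
the vertical term removes `(0, Dσ u + Γ(u, p))`. The derivative of `σ` cancels, so the choice of
extension does not matter. -/
lemma chartDeriv_hlift {v p : TangentBundle 𝓘(ℝ, E) Q}
    (hp : p.proj ∈ (extChartAt 𝓘(ℝ, E) v.proj).source) (u : TangentSpace 𝓘(ℝ, E) p.proj) :
    chartDeriv 𝓘(ℝ, E).tangent v p (hlift cov p u) =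
      (chartDeriv 𝓘(ℝ, E) v.proj p.proj u,
        -christoffel cov v.proj (extChartAt 𝓘(ℝ, E) v.proj p.proj)
          (chartDeriv 𝓘(ℝ, E) v.proj p.proj u) (chartDeriv 𝓘(ℝ, E) v.proj p.proj p.snd)) := by
  have hσ : MDifferentiableAt 𝓘(ℝ, E) 𝓘(ℝ, E).tangent
      (fun x : Q => (⟨x, FiberBundle.extend E p.snd x⟩ : TangentBundle 𝓘(ℝ, E) Q)) p.proj :=
    FiberBundle.mdifferentiableAt_extend 𝓘(ℝ, E) E p.snd
  have hv : (⟨p.proj, FiberBundle.extend E p.snd p.proj⟩ : TangentBundle 𝓘(ℝ, E) Q) = p := by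
    rw [FiberBundle.extend_apply_self]
  have h1 := chartDeriv_mfderiv_section (v := v) hp hσ u
  have h1' : chartDeriv 𝓘(ℝ, E).tangent v p (mfderiv 𝓘(ℝ, E) 𝓘(ℝ, E).tangent
      (fun x => (⟨x, FiberBundle.extend E p.snd x⟩ : TangentBundle 𝓘(ℝ, E) Q)) p.proj u) = _ :=
    Eq.trans (by rw [hv]) h1
  have h2 := chartDeriv_vlift hp (cov (FiberBundle.extend E p.snd) p.proj u)
  rw [chartDeriv_cov cov hp hσ, modelCov, coordRep_apply hp,
    FiberBundle.extend_apply_self] at h2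
  refine (map_sub (chartDeriv 𝓘(ℝ, E).tangent v p) _ _).trans ?_
  refine (congrArg₂ (fun a b : E × E => a - b) h1' h2).trans ?_
  ext <;> simp

lemma coordRep_spray {v : TangentBundle 𝓘(ℝ, E) Q} {z : E × E}
    (hz : z ∈ (extChartAt 𝓘(ℝ, E).tangent v).target) :
    coordRep 𝓘(ℝ, E).tangent v (spray cov) z = modelSpray (christoffel cov v.proj) z := by
  have h1 := (extChartAt 𝓘(ℝ, E).tangent v).map_target hz
  have h2 := mem_extChartAt_tangent_source.1 h1
  have h3 := extChartAt_tangent_apply h2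
  rw [(extChartAt 𝓘(ℝ, E).tangent v).right_inv hz] at h3
  exact (chartDeriv_hlift cov h2 _).trans (congrArg (modelSpray _) h3.symm)

/-- By the formulas for the lifts, a tangent vector with coordinates `(a, b)` has horizontal
component `a` and vertical component `b + Γ(a, p)`. -/
lemma mem_map_splitting_iff (D : ∀ q : Q, Submodule ℝ (TangentSpace 𝓘(ℝ, E) q))
    {v p : TangentBundle 𝓘(ℝ, E) Q} (hp : p.proj ∈ (extChartAt 𝓘(ℝ, E) v.proj).source)
    (X : TangentSpace 𝓘(ℝ, E).tangent p) :
    X ∈ ((D p.proj).prod (D p.proj)).map (splitting cov p).toLinearMap ↔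
      (chartDeriv 𝓘(ℝ, E).tangent v p X).1 ∈
        (D p.proj).map (chartDeriv 𝓘(ℝ, E) v.proj p.proj).toLinearMap ∧
      (chartDeriv 𝓘(ℝ, E).tangent v p X).2 +
        christoffel cov v.proj (extChartAt 𝓘(ℝ, E) v.proj p.proj)
          (chartDeriv 𝓘(ℝ, E).tangent v p X).1 (chartDeriv 𝓘(ℝ, E) v.proj p.proj p.snd) ∈
        (D p.proj).map (chartDeriv 𝓘(ℝ, E) v.proj p.proj).toLinearMap := by
  obtain ⟨⟨a, b⟩, rfl⟩ := (splitting cov p).surjective X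
  have h1 : chartDeriv 𝓘(ℝ, E).tangent v p (splitting cov p (a, b)) =
      (chartDeriv 𝓘(ℝ, E) v.proj p.proj a,
        -christoffel cov v.proj (extChartAt 𝓘(ℝ, E) v.proj p.proj)
          (chartDeriv 𝓘(ℝ, E) v.proj p.proj a) (chartDeriv 𝓘(ℝ, E) v.proj p.proj p.snd) +
          chartDeriv 𝓘(ℝ, E) v.proj p.proj b) := by
    rw [splitting_apply, map_add, chartDeriv_hlift cov hp, chartDeriv_vlift hp]
    simp
  have h2 (c : TangentSpace 𝓘(ℝ, E) p.proj) : chartDeriv 𝓘(ℝ, E) v.proj p.proj c ∈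
      (D p.proj).map (chartDeriv 𝓘(ℝ, E) v.proj p.proj).toLinearMap ↔ c ∈ D p.proj :=
    (chartDeriv_injective hp).mem_set_image
  have h3 : splitting cov p (a, b) ∈
      ((D p.proj).prod (D p.proj)).map (splitting cov p).toLinearMap ↔
      (a, b) ∈ (D p.proj).prod (D p.proj) :=
    (splitting cov p).injective.mem_set_image
  rw [h3, h1]
  simp only [neg_add_cancel_comm]
  rw [h2, h2]
  rfl

end TangentCoordinates

/-! ### Transfer of the hypotheses on `D` and the connection to a chart. -/

section LocalTransfer

open Filter VectorField Set

variable {E : Type*} [NormedAddCommGroup E] [NormedSpace ℝ E]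
  {Q : Type*} [TopologicalSpace Q] [ChartedSpace E Q]
  {D : ∀ q : Q, Submodule ℝ (TangentSpace 𝓘(ℝ, E) q)} {q₀ q : Q}

/-- The distribution `D` in the chart at `q₀`. -/
def coordDist (D : ∀ q : Q, Submodule ℝ (TangentSpace 𝓘(ℝ, E) q)) (q₀ : Q) (y : E) :
    Submodule ℝ E :=
  (D ((extChartAt 𝓘(ℝ, E) q₀).symm y)).map
    (chartDeriv 𝓘(ℝ, E) q₀ ((extChartAt 𝓘(ℝ, E) q₀).symm y)).toLinearMap

lemma coordDist_apply (hq : q ∈ (extChartAt 𝓘(ℝ, E) q₀).source) :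
    coordDist D q₀ (extChartAt 𝓘(ℝ, E) q₀ q) =
      (D q).map (chartDeriv 𝓘(ℝ, E) q₀ q).toLinearMap := by
  rw [coordDist, (extChartAt 𝓘(ℝ, E) q₀).left_inv hq]

variable [IsManifold 𝓘(ℝ, E) ω Q]

lemma chartDeriv_mem_coordDist (hq : q ∈ (extChartAt 𝓘(ℝ, E) q₀).source)
    {u : TangentSpace 𝓘(ℝ, E) q} :
    chartDeriv 𝓘(ℝ, E) q₀ q u ∈ coordDist D q₀ (extChartAt 𝓘(ℝ, E) q₀ q) ↔ u ∈ D q := by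
  rw [coordDist_apply hq]
  exact (chartDeriv_injective hq).mem_set_image

lemma IsSectionOn.isSectionNear {U : Set Q} (hU : IsOpen U)
    {Y : ∀ q : Q, TangentSpace 𝓘(ℝ, E) q} (hY : IsSectionOn 𝓘(ℝ, E) D Y U) (hqU : q ∈ U)
    (hq : q ∈ (extChartAt 𝓘(ℝ, E) q₀).source) :
    IsSectionNear (coordDist D q₀) (coordRep 𝓘(ℝ, E) q₀ Y) (extChartAt 𝓘(ℝ, E) q₀ q) := by
  refine ⟨(contMDiffAt_iff_coordRep hq).1 ((hY.1 q hqU).contMDiffAt (hU.mem_nhds hqU)), ?_⟩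
  have h1 := continuousAt_extChartAt_symm' (I := 𝓘(ℝ, E)) hq
  have h2 : U ∈ 𝓝 ((extChartAt 𝓘(ℝ, E) q₀).symm (extChartAt 𝓘(ℝ, E) q₀ q)) := by
    rw [(extChartAt 𝓘(ℝ, E) q₀).left_inv hq]
    exact hU.mem_nhds hqU
  filter_upwards [h1.preimage_mem_nhds h2] with z hz
  exact Submodule.mem_map_of_mem (hY.2 _ hz)

lemma IsSectionNear.exists_isSectionOn {Y : E → E}
    (hq : q ∈ (extChartAt 𝓘(ℝ, E) q₀).source)
    (hY : IsSectionNear (coordDist D q₀) Y (extChartAt 𝓘(ℝ, E) q₀ q)) :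
    ∃ U : Set Q, IsOpen U ∧ q ∈ U ∧ U ⊆ (extChartAt 𝓘(ℝ, E) q₀).source ∧
      IsSectionOn 𝓘(ℝ, E) D
        (fun x => constField 𝓘(ℝ, E) q₀ (Y (extChartAt 𝓘(ℝ, E) q₀ x)) x) U := by
  have h1 : ∀ᶠ x in 𝓝 q, (ContDiffAt ℝ ω Y (extChartAt 𝓘(ℝ, E) q₀ x) ∧
      Y (extChartAt 𝓘(ℝ, E) q₀ x) ∈ coordDist D q₀ (extChartAt 𝓘(ℝ, E) q₀ x)) ∧
      x ∈ (extChartAt 𝓘(ℝ, E) q₀).source :=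
    ((continuousAt_extChartAt' (I := 𝓘(ℝ, E)) hq).eventually
      ((hY.1.eventually (by simp)).and hY.2)).and ((isOpen_extChartAt_source q₀).mem_nhds hq)
  obtain ⟨U, hU, hUo, hqU⟩ := eventually_nhds_iff.1 h1
  refine ⟨U, hUo, hqU, fun x hx => (hU x hx).2, fun x hx => ?_, fun x hx => ?_⟩
  · have hx' := (hU x hx).2
    refine ((contMDiffAt_iff_coordRep hx').2 ?_).contMDiffWithinAt
    refine (hU x hx).1.1.congr_of_eventuallyEq ?_
    filter_upwards [extChartAt_target_mem_nhds' ((extChartAt 𝓘(ℝ, E) q₀).map_source hx')]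
      with z hz
    rw [coordRep, chartDeriv_constField ((extChartAt 𝓘(ℝ, E) q₀).map_target hz),
      (extChartAt 𝓘(ℝ, E) q₀).right_inv hz]
  · rw [← chartDeriv_mem_coordDist (hU x hx).2, chartDeriv_constField (hU x hx).2]
    exact (hU x hx).1.2

lemma coordRep_constField_comp_eventuallyEq (hq : q ∈ (extChartAt 𝓘(ℝ, E) q₀).source)
    (Y : E → E) :
    coordRep 𝓘(ℝ, E) q₀ (fun x => constField 𝓘(ℝ, E) q₀ (Y (extChartAt 𝓘(ℝ, E) q₀ x)) x)
      =ᶠ[𝓝 (extChartAt 𝓘(ℝ, E) q₀ q)] Y := by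
  filter_upwards [extChartAt_target_mem_nhds' ((extChartAt 𝓘(ℝ, E) q₀).map_source hq)] with z hz
  rw [coordRep, chartDeriv_constField ((extChartAt 𝓘(ℝ, E) q₀).map_target hz),
    (extChartAt 𝓘(ℝ, E) q₀).right_inv hz]

lemma IsAnalyticDistribution.exists_isSectionNear (hD : IsAnalyticDistribution 𝓘(ℝ, E) D)
    (hq : q ∈ (extChartAt 𝓘(ℝ, E) q₀).source) {u : E}
    (hu : u ∈ coordDist D q₀ (extChartAt 𝓘(ℝ, E) q₀ q)) :
    ∃ Y, IsSectionNear (coordDist D q₀) Y (extChartAt 𝓘(ℝ, E) q₀ q) ∧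
      Y (extChartAt 𝓘(ℝ, E) q₀ q) = u := by
  rw [coordDist_apply hq] at hu
  obtain ⟨w, hw, rfl⟩ := hu
  obtain ⟨U, hU, hqU, Y, hY, rfl⟩ := hD q w hw
  exact ⟨_, hY.isSectionNear hU hqU hq, coordRep_apply hq⟩

variable [FiniteDimensional ℝ E]
  {cov : CovariantDerivative 𝓘(ℝ, E) E (TangentSpace 𝓘(ℝ, E) : Q → Type _)}

lemma RestrictsTo.modelCov_mem (h : RestrictsTo cov D)
    (hq : q ∈ (extChartAt 𝓘(ℝ, E) q₀).source) {Y : E → E}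
    (hY : IsSectionNear (coordDist D q₀) Y (extChartAt 𝓘(ℝ, E) q₀ q)) (u : E) :
    modelCov (christoffel cov q₀) Y (extChartAt 𝓘(ℝ, E) q₀ q) u ∈
      coordDist D q₀ (extChartAt 𝓘(ℝ, E) q₀ q) := by
  obtain ⟨U, hU, hqU, hUs, hYU⟩ := hY.exists_isSectionOn hq
  have h1 := h U (constField 𝓘(ℝ, E) q₀ u) _ hU
    (fun x hx => (contMDiffAt_constField (hUs hx) u).contMDiffWithinAt) hYU q hqU
  have h2 := ((hYU.1 q hqU).contMDiffAt (hU.mem_nhds hqU)).mdifferentiableAt (by simp)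
  rw [← chartDeriv_mem_coordDist hq, chartDeriv_cov cov hq h2, chartDeriv_constField hq] at h1
  have h3 := coordRep_constField_comp_eventuallyEq hq Y
  rw [modelCov, h3.fderiv_eq, h3.self_of_nhds] at h1
  exact h1

lemma RestrictsTo.eventually_modelCov_mem (h : RestrictsTo cov D) (q₀ : Q) :
    ∀ᶠ z in 𝓝 (extChartAt 𝓘(ℝ, E) q₀ q₀), ∀ Y, IsSectionNear (coordDist D q₀) Y z →
      ∀ u, modelCov (christoffel cov q₀) Y z u ∈ coordDist D q₀ z := by
  filter_upwards [extChartAt_target_mem_nhds (I := 𝓘(ℝ, E)) q₀] with z hz Y hY u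
  have h1 := (extChartAt 𝓘(ℝ, E) q₀).map_target hz
  rw [← (extChartAt 𝓘(ℝ, E) q₀).right_inv hz] at hY ⊢
  exact h.modelCov_mem h1 hY u

/-- Torsion is evaluated on fields constant in the chart, whose bracket vanishes. -/
lemma chartDeriv_torsion [CompleteSpace E] (u w : TangentSpace 𝓘(ℝ, E) q₀) :
    chartDeriv 𝓘(ℝ, E) q₀ q₀ (cov.torsion q₀ u w) =
      christoffel cov q₀ (extChartAt 𝓘(ℝ, E) q₀ q₀) (chartDeriv 𝓘(ℝ, E) q₀ q₀ u)
          (chartDeriv 𝓘(ℝ, E) q₀ q₀ w) -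
        christoffel cov q₀ (extChartAt 𝓘(ℝ, E) q₀ q₀) (chartDeriv 𝓘(ℝ, E) q₀ q₀ w)
          (chartDeriv 𝓘(ℝ, E) q₀ q₀ u) := by
  have hs := mem_extChartAt_source (I := 𝓘(ℝ, E)) q₀
  have hσ (w : E) := (contMDiffAt_constField (I := 𝓘(ℝ, E)) hs w).mdifferentiableAt (by simp)
  have h1 := cov.torsion_apply (hσ (chartDeriv 𝓘(ℝ, E) q₀ q₀ u))
    (hσ (chartDeriv 𝓘(ℝ, E) q₀ q₀ w))
  have h2 (u w : TangentSpace 𝓘(ℝ, E) q₀) : chartDeriv 𝓘(ℝ, E) q₀ q₀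
      (cov (constField 𝓘(ℝ, E) q₀ (chartDeriv 𝓘(ℝ, E) q₀ q₀ w)) q₀ u) =
      christoffel cov q₀ (extChartAt 𝓘(ℝ, E) q₀ q₀) (chartDeriv 𝓘(ℝ, E) q₀ q₀ u)
        (chartDeriv 𝓘(ℝ, E) q₀ q₀ w) := by
    have h3 := coordRep_constField_eventuallyEq (I := 𝓘(ℝ, E)) hs (chartDeriv 𝓘(ℝ, E) q₀ q₀ w)
    rw [chartDeriv_cov cov hs (hσ _), modelCov, h3.fderiv_eq, h3.self_of_nhds]
    simp
  rw [constField_chartDeriv hs, constField_chartDeriv hs, mlieBracket_constField, sub_zero] at h1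
  rw [h1, map_sub, h2, h2]

lemma TorsionPreserves.christoffel_mem (h : TorsionPreserves cov D) {u w : E}
    (hu : u ∈ coordDist D q₀ (extChartAt 𝓘(ℝ, E) q₀ q₀))
    (hw : w ∈ coordDist D q₀ (extChartAt 𝓘(ℝ, E) q₀ q₀)) :
    christoffel cov q₀ (extChartAt 𝓘(ℝ, E) q₀ q₀) u w -
      christoffel cov q₀ (extChartAt 𝓘(ℝ, E) q₀ q₀) w u ∈
        coordDist D q₀ (extChartAt 𝓘(ℝ, E) q₀ q₀) := by
  have hc : CompleteSpace E := FiniteDimensional.complete ℝ E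
  have hs := mem_extChartAt_source (I := 𝓘(ℝ, E)) q₀
  rw [coordDist_apply hs] at hu hw
  obtain ⟨u, hu, rfl⟩ := hu
  obtain ⟨w, hw, rfl⟩ := hw
  have h1 := (chartDeriv_mem_coordDist hs).2 (h q₀ u hu w hw)
  rwa [chartDeriv_torsion] at h1

/-- `Γ(u, w)` is the coordinate form of `∇_u w` for the constant fields `u`, `w`. In finite
dimension, analyticity of these values gives analyticity of the operator-valued map. -/
lemma IsAnalyticConnection.contDiffAt_christoffel (h : IsAnalyticConnection cov) (q₀ : Q) :
    ContDiffAt ℝ ω (christoffel cov q₀) (extChartAt 𝓘(ℝ, E) q₀ q₀) := by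
  have key (u w : E) : ContDiffOn ℝ ω (fun y => christoffel cov q₀ y u w)
      (extChartAt 𝓘(ℝ, E) q₀).target := by
    intro y hy
    have hs : IsOpen (extChartAt 𝓘(ℝ, E) q₀).source := isOpen_extChartAt_source q₀
    have hq := (extChartAt 𝓘(ℝ, E) q₀).map_target hy
    have h1 := (h _ hs).contMDiff (σ := constField 𝓘(ℝ, E) q₀ w)
      fun x hx => (contMDiffAt_constField hx w).contMDiffWithinAt
    have h2 := ((h1 _ hq).contMDiffAt (hs.mem_nhds hq)).clm_bundle_apply
      (contMDiffAt_constField hq u)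
    have h4 := (contMDiffAt_iff_coordRep hq).1 h2
    rw [(extChartAt 𝓘(ℝ, E) q₀).right_inv hy] at h4
    refine h4.contDiffWithinAt.congr_of_mem (fun z hz => ?_) hy
    have hz' := (extChartAt 𝓘(ℝ, E) q₀).map_target hz
    have h3 := coordRep_constField_eventuallyEq (I := 𝓘(ℝ, E)) hz' w
    rw [coordRep, chartDeriv_cov cov hz'
      ((contMDiffAt_constField hz' w).mdifferentiableAt (by simp)), modelCov, h3.fderiv_eq,
      h3.self_of_nhds, chartDeriv_constField hz', (extChartAt 𝓘(ℝ, E) q₀).right_inv hz]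
    simp
  have h5 : ContDiffOn ℝ ω (christoffel cov q₀) (extChartAt 𝓘(ℝ, E) q₀).target :=
    contDiffOn_clm_apply.2 fun u => contDiffOn_clm_apply.2 fun w => key u w
  exact h5.contDiffAt (extChartAt_target_mem_nhds q₀)

end LocalTransfer

/-! ### The smallest invariant family and its analyticity. -/

section InvariantHull

open Filter VectorField Set

variable {E : Type*} [NormedAddCommGroup E] [NormedSpace ℝ E]
  {H : Type*} [TopologicalSpace H] {I : ModelWithCorners ℝ E H}
  {M : Type*} [TopologicalSpace M] [ChartedSpace H M] [IsManifold I ω M]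

lemma IsSectionOn.mono {D D' : ∀ x : M, Submodule ℝ (TangentSpace I x)}
    {Y : ∀ x : M, TangentSpace I x} {U : Set M} (h : IsSectionOn I D Y U) (hD : D ≤ D') :
    IsSectionOn I D' Y U :=
  ⟨h.1, fun x hx => hD x (h.2 x hx)⟩

variable (I) in
/-- The values of the local analytic sections of a family of tangent subspaces. -/
def sectionValues (F : ∀ x : M, Submodule ℝ (TangentSpace I x)) (x : M) :
    Submodule ℝ (TangentSpace I x) where
  carrier := {u | ∃ U : Set M, IsOpen U ∧ x ∈ U ∧
    ∃ Y : ∀ y : M, TangentSpace I y, IsSectionOn I F Y U ∧ Y x = u}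
  add_mem' := by
    rintro _ _ ⟨U, hU, hxU, Y, hY, rfl⟩ ⟨V, hV, hxV, W, hW, rfl⟩
    refine ⟨U ∩ V, hU.inter hV, ⟨hxU, hxV⟩, Y + W, ⟨?_, fun y hy => ?_⟩, rfl⟩
    · exact (ContMDiffOn.mono hY.1 inter_subset_left).add_section
        (ContMDiffOn.mono hW.1 inter_subset_right)
    · exact (F y).add_mem (hY.2 y hy.1) (hW.2 y hy.2)
  zero_mem' := ⟨univ, isOpen_univ, mem_univ x, 0,
    ⟨(Bundle.contMDiff_zeroSection ℝ (TangentSpace I)).contMDiffOn, fun y _ => (F y).zero_mem⟩, rfl⟩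
  smul_mem' := by
    rintro c _ ⟨U, hU, hxU, Y, hY, rfl⟩
    exact ⟨U, hU, hxU, c • Y, ⟨ContMDiffOn.const_smul_section hY.1,
      fun y hy => (F y).smul_mem c (hY.2 y hy)⟩, rfl⟩

lemma sectionValues_le (F : ∀ x : M, Submodule ℝ (TangentSpace I x)) : sectionValues I F ≤ F := by
  rintro x _ ⟨U, -, hxU, Y, hY, rfl⟩
  exact hY.2 x hxU

lemma IsSectionOn.mem_sectionValues {F : ∀ x : M, Submodule ℝ (TangentSpace I x)}
    {Y : ∀ x : M, TangentSpace I x} {U : Set M} (hU : IsOpen U) (h : IsSectionOn I F Y U) {x : M}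
    (hx : x ∈ U) : Y x ∈ sectionValues I F x :=
  ⟨U, hU, hx, Y, h, rfl⟩

variable (I) in
/-- The smallest family of tangent subspaces that contains `S` and is invariant under `Z`. -/
def invariantHull (Z : ∀ x : M, TangentSpace I x) (S : ∀ x : M, Submodule ℝ (TangentSpace I x)) :
    ∀ x : M, Submodule ℝ (TangentSpace I x) :=
  sInf {G | S ≤ G ∧ IsInvariantUnder I Z G}

variable {Z : ∀ x : M, TangentSpace I x} {S G : ∀ x : M, Submodule ℝ (TangentSpace I x)}

lemma invariantHull_le (h : S ≤ G) (hG : IsInvariantUnder I Z G) : invariantHull I Z S ≤ G :=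
  sInf_le ⟨h, hG⟩

lemma le_invariantHull : S ≤ invariantHull I Z S :=
  le_sInf fun _ h => h.1

lemma isInvariantUnder_invariantHull : IsInvariantUnder I Z (invariantHull I Z S) := by
  intro U ξ hU hξ x hx
  simp only [invariantHull, sInf_apply, Submodule.mem_iInf]
  rintro ⟨G, hG⟩
  exact hG.2 U ξ hU (hξ.mono (invariantHull_le hG.1 hG.2)) x hx

variable [CompleteSpace E]

/-- The values of analytic sections of the hull form a family that again contains `S` and is
invariant, so minimality forces the hull to consist of such values. -/
lemma isAnalyticDistribution_invariantHull (hZ : IsAnalyticFieldOn I Z univ)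
    (hS : IsAnalyticDistribution I S) : IsAnalyticDistribution I (invariantHull I Z S) := by
  have h1 : invariantHull I Z S ≤ sectionValues I (invariantHull I Z S) := by
    refine invariantHull_le (fun x u hu => ?_) fun U ξ hU hξ x hx => ?_
    · obtain ⟨U, hU, hxU, Y, hY, rfl⟩ := hS x u hu
      exact (hY.mono le_invariantHull).mem_sectionValues hU hxU
    · have hξ' := hξ.mono (sectionValues_le _)
      have h2 : IsSectionOn I (invariantHull I Z S) (mlieBracket I Z ξ) U := by
        refine ⟨fun y hy => ?_, isInvariantUnder_invariantHull U ξ hU hξ'⟩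
        -- `ω + 1` is `ω`: the bracket costs no regularity.
        have hM : IsManifold I (ω + 1) M := ‹IsManifold I ω M›
        have hZy := hZ y (mem_univ y)
        have hξy := ((hξ.1 y hy).contMDiffAt (hU.mem_nhds hy)).contMDiffWithinAt (s := univ)
        have h3 := hZy.mlieBracketWithin_vectorField hξy uniqueMDiffOn_univ (mem_univ y)
          (m := ω) le_top
        rw [mlieBracketWithin_univ] at h3
        exact h3.mono (subset_univ U)
      exact h2.mem_sectionValues hU hx
  exact fun x u hu => h1 x hu

end InvariantHull

/-! ### Bounding the invariant hull of the vertical lift from both sides. -/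

section SprayDistribution

open Filter VectorField Set

variable {E : Type*} [NormedAddCommGroup E] [NormedSpace ℝ E]
  {Q : Type*} [TopologicalSpace Q] [ChartedSpace E Q] [IsManifold 𝓘(ℝ, E) ω Q]
  {D : ∀ q : Q, Submodule ℝ (TangentSpace 𝓘(ℝ, E) q)}

/-- The vertical lift of the vector field `Y`. -/
def vliftField (Y : ∀ q : Q, TangentSpace 𝓘(ℝ, E) q) (p : TangentBundle 𝓘(ℝ, E) Q) :
    TangentSpace 𝓘(ℝ, E).tangent p :=
  vlift p (Y p.proj)

/-- The vertical lift of the distribution `D`. -/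
def vliftDist (D : ∀ q : Q, Submodule ℝ (TangentSpace 𝓘(ℝ, E) q))
    (p : TangentBundle 𝓘(ℝ, E) Q) : Submodule ℝ (TangentSpace 𝓘(ℝ, E).tangent p) :=
  (D p.proj).map (vlift p).toLinearMap

lemma containsVerticalLift_iff
    {F : ∀ v : TangentBundle 𝓘(ℝ, E) Q, Submodule ℝ (TangentSpace 𝓘(ℝ, E).tangent v)} :
    ContainsVerticalLift D F ↔ vliftDist D ≤ F :=
  forall_congr' fun _ => Submodule.map_le_iff_le_comap.symm

lemma coordRep_vliftField (Y : ∀ q : Q, TangentSpace 𝓘(ℝ, E) q) {v : TangentBundle 𝓘(ℝ, E) Q}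
    {z : E × E} (hz : z ∈ (extChartAt 𝓘(ℝ, E).tangent v).target) :
    coordRep 𝓘(ℝ, E).tangent v (vliftField Y) z = (0, coordRep 𝓘(ℝ, E) v.proj Y z.1) := by
  have h1 := (extChartAt 𝓘(ℝ, E).tangent v).map_target hz
  have h2 := mem_extChartAt_tangent_source.1 h1
  have h3 := extChartAt_tangent_apply h2
  rw [(extChartAt 𝓘(ℝ, E).tangent v).right_inv hz] at h3
  refine (chartDeriv_vlift h2 _).trans ?_
  rw [← coordRep_apply h2]
  exact congrArg (fun z : E × E => ((0 : E), coordRep 𝓘(ℝ, E) v.proj Y z.1)) h3.symm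

lemma coordRep_vliftField_eventuallyEq (Y : ∀ q : Q, TangentSpace 𝓘(ℝ, E) q)
    (v : TangentBundle 𝓘(ℝ, E) Q) :
    coordRep 𝓘(ℝ, E).tangent v (vliftField Y) =ᶠ[𝓝 (extChartAt 𝓘(ℝ, E).tangent v v)]
      fun z => (0, coordRep 𝓘(ℝ, E) v.proj Y z.1) := by
  filter_upwards [extChartAt_target_mem_nhds (I := 𝓘(ℝ, E).tangent) v] with z hz
  exact coordRep_vliftField Y hz

lemma IsSectionOn.vliftField {Y : ∀ q : Q, TangentSpace 𝓘(ℝ, E) q} {U : Set Q} (hU : IsOpen U)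
    (hY : IsSectionOn 𝓘(ℝ, E) D Y U) :
    IsSectionOn 𝓘(ℝ, E).tangent (vliftDist D) (vliftField Y)
      ((Bundle.TotalSpace.proj : TangentBundle 𝓘(ℝ, E) Q → Q) ⁻¹' U) := by
  refine ⟨fun v hv => ?_, fun v hv => Submodule.mem_map_of_mem (hY.2 _ hv)⟩
  refine ((contMDiffAt_iff_coordRep (mem_extChartAt_source v)).2 ?_).contMDiffWithinAt
  refine ContDiffAt.congr_of_eventuallyEq ?_ (coordRep_vliftField_eventuallyEq Y v)
  have h1 := (hY.isSectionNear hU hv (mem_extChartAt_source v.proj)).1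
  rw [extChartAt_tangent_self]
  exact contDiffAt_const.prodMk (ContDiffAt.comp (g := coordRep 𝓘(ℝ, E) v.proj Y) (_ : E × E)
    h1 contDiffAt_fst)

lemma IsAnalyticDistribution.vliftDist (hD : IsAnalyticDistribution 𝓘(ℝ, E) D) :
    IsAnalyticDistribution 𝓘(ℝ, E).tangent (vliftDist D) := by
  rintro v _ ⟨w, hw, rfl⟩
  obtain ⟨U, hU, hqU, Y, hY, rfl⟩ := hD v.proj w hw
  exact ⟨_, hU.preimage (FiberBundle.continuous_proj E (TangentSpace 𝓘(ℝ, E))), hqU,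
    AffineSpray.vliftField Y, hY.vliftField hU, rfl⟩

variable [FiniteDimensional ℝ E]
  {cov : CovariantDerivative 𝓘(ℝ, E) E (TangentSpace 𝓘(ℝ, E) : Q → Type _)}

lemma coordRep_spray_eventuallyEq (v : TangentBundle 𝓘(ℝ, E) Q) :
    coordRep 𝓘(ℝ, E).tangent v (spray cov) =ᶠ[𝓝 (extChartAt 𝓘(ℝ, E).tangent v v)]
      modelSpray (christoffel cov v.proj) := by
  filter_upwards [extChartAt_target_mem_nhds (I := 𝓘(ℝ, E).tangent) v] with z hz
  exact coordRep_spray cov hz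

lemma IsAnalyticConnection.isAnalyticFieldOn_spray (hcov : IsAnalyticConnection cov) :
    IsAnalyticFieldOn 𝓘(ℝ, E).tangent (spray cov) univ := by
  intro v _
  refine ((contMDiffAt_iff_coordRep (mem_extChartAt_source v)).2 ?_).contMDiffWithinAt
  refine ContDiffAt.congr_of_eventuallyEq ?_ (coordRep_spray_eventuallyEq v)
  rw [extChartAt_tangent_self]
  exact contDiffAt_modelSpray (hcov.contDiffAt_christoffel v.proj)

/-- The bracket of the spray with a vertical lift. -/
lemma mlieBracket_spray_vliftField (hcov : IsAnalyticConnection cov)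
    {Y : ∀ q : Q, TangentSpace 𝓘(ℝ, E) q} {v : TangentBundle 𝓘(ℝ, E) Q}
    (hY : MDifferentiableAt 𝓘(ℝ, E) 𝓘(ℝ, E).tangent
      (fun x => (⟨x, Y x⟩ : TangentBundle 𝓘(ℝ, E) Q)) v.proj) :
    mlieBracket 𝓘(ℝ, E).tangent (spray cov) (vliftField Y) v =
      vlift v (cov Y v.proj v.snd) - hlift cov v (Y v.proj) := by
  have hs := mem_extChartAt_source (I := 𝓘(ℝ, E)) v.proj
  have hG := (hcov.contDiffAt_christoffel v.proj).differentiableAt (by simp)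
  have hYd := differentiableAt_coordRep hs hY
  have h1 := chartDeriv_mlieBracket (I := 𝓘(ℝ, E).tangent) (V := spray cov)
    (W := vliftField Y) (x₀ := v)
  rw [(coordRep_spray_eventuallyEq v).lieBracket_vectorField_eq
    (coordRep_vliftField_eventuallyEq Y v), extChartAt_tangent_self] at h1
  have hb : HasFDerivAt (fun z : E × E => coordRep 𝓘(ℝ, E) v.proj Y z.1) _
      (extChartAt 𝓘(ℝ, E) v.proj v.proj, chartDeriv 𝓘(ℝ, E) v.proj v.proj v.snd) :=
    HasFDerivAt.comp (g := coordRep 𝓘(ℝ, E) v.proj Y) (_ : E × E) hYd.hasFDerivAt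
      hasFDerivAt_fst
  have h2 := lieBracket_modelSpray (v := chartDeriv 𝓘(ℝ, E) v.proj v.proj v.snd) hG
    (differentiableAt_const (0 : E)) hb.differentiableAt
  have h0 := (fderiv ℝ (christoffel cov v.proj) (extChartAt 𝓘(ℝ, E) v.proj v.proj)).map_zero
  rw [hb.fderiv, h0] at h2
  apply chartDeriv_injective (mem_extChartAt_source v)
  rw [map_sub, chartDeriv_hlift cov hs, chartDeriv_vlift hs, chartDeriv_cov cov hs hY]
  refine (h1.trans h2).trans ?_
  have h3 := coordRep_apply (X := Y) hs
  rw [← h3, modelCov]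
  ext
  · simp
  · simp
    abel

/-- The family that is `D ⊕ D` in the splitting along `D`, and everything elsewhere. -/
def splitDist (cov : CovariantDerivative 𝓘(ℝ, E) E (TangentSpace 𝓘(ℝ, E) : Q → Type _))
    (D : ∀ q : Q, Submodule ℝ (TangentSpace 𝓘(ℝ, E) q)) (v : TangentBundle 𝓘(ℝ, E) Q) :
    Submodule ℝ (TangentSpace 𝓘(ℝ, E).tangent v) :=
  ⨅ _ : v.snd ∈ D v.proj, ((D v.proj).prod (D v.proj)).map (splitting cov v).toLinearMap

lemma mem_splitDist {v : TangentBundle 𝓘(ℝ, E) Q} {X : TangentSpace 𝓘(ℝ, E).tangent v} :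
    X ∈ splitDist cov D v ↔ (v.snd ∈ D v.proj →
      X ∈ ((D v.proj).prod (D v.proj)).map (splitting cov v).toLinearMap) := by
  rw [splitDist, Submodule.mem_iInf]

lemma vliftDist_le_splitDist : vliftDist D ≤ splitDist cov D := by
  rintro v _ ⟨w, hw, rfl⟩
  refine mem_splitDist.2 fun _ => ⟨(0, w), ⟨(D v.proj).zero_mem, hw⟩, ?_⟩
  refine (splitting_apply cov v 0 w).trans ?_
  rw [map_zero, zero_add]
  rfl

/-- Only points `v ∈ D` impose a condition. There, in the chart at `v`, a section of the family
satisfies the hypothesis of `lieBracket_modelSpray_mem`, which constrains it only along `D`. -/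
lemma isInvariantUnder_splitDist (hcov : IsAnalyticConnection cov)
    (hD : IsAnalyticDistribution 𝓘(ℝ, E) D) (hrestrict : RestrictsTo cov D)
    (htorsion : TorsionPreserves cov D) :
    IsInvariantUnder 𝓘(ℝ, E).tangent (spray cov) (splitDist cov D) := by
  intro U ξ hU hξ v hv
  refine mem_splitDist.2 fun hvD => ?_
  have hs := mem_extChartAt_source (I := 𝓘(ℝ, E)) v.proj
  have hΦ := extChartAt_tangent_self v
  have hξc : ContDiffAt ℝ ω (coordRep 𝓘(ℝ, E).tangent v ξ)
      (extChartAt 𝓘(ℝ, E) v.proj v.proj, chartDeriv 𝓘(ℝ, E) v.proj v.proj v.snd) := by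
    rw [← hΦ]
    exact (contMDiffAt_iff_coordRep (mem_extChartAt_source v)).1
      ((hξ.1 v hv).contMDiffAt (hU.mem_nhds hv))
  have hξD : ∀ᶠ z in 𝓝 (extChartAt 𝓘(ℝ, E) v.proj v.proj, chartDeriv 𝓘(ℝ, E) v.proj v.proj v.snd),
      z.2 ∈ coordDist D v.proj z.1 →
      (coordRep 𝓘(ℝ, E).tangent v ξ z).1 ∈ coordDist D v.proj z.1 ∧
      (coordRep 𝓘(ℝ, E).tangent v ξ z).2 + christoffel cov v.proj z.1
        (coordRep 𝓘(ℝ, E).tangent v ξ z).1 z.2 ∈ coordDist D v.proj z.1 := by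
    have h1 : (extChartAt 𝓘(ℝ, E).tangent v).symm ⁻¹' U ∈
        𝓝 (extChartAt 𝓘(ℝ, E).tangent v v) := by
      refine (continuousAt_extChartAt_symm (I := 𝓘(ℝ, E).tangent) v).preimage_mem_nhds ?_
      rw [extChartAt_to_inv]
      exact hU.mem_nhds hv
    rw [← hΦ]
    filter_upwards [extChartAt_target_mem_nhds (I := 𝓘(ℝ, E).tangent) v, h1] with z hz hzU hzD
    have hp := (extChartAt 𝓘(ℝ, E).tangent v).map_target hz
    set p := (extChartAt 𝓘(ℝ, E).tangent v).symm z with hpdef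
    have hzp : z = extChartAt 𝓘(ℝ, E).tangent v p :=
      ((extChartAt 𝓘(ℝ, E).tangent v).right_inv hz).symm
    have hp' := mem_extChartAt_tangent_source.1 hp
    rw [hzp, coordRep_apply hp]
    rw [hzp] at hzD
    rw [extChartAt_tangent_apply hp'] at hzD ⊢
    have h2 := mem_splitDist.1 (hξ.2 p hzU) ((chartDeriv_mem_coordDist hp').1 hzD)
    rw [mem_map_splitting_iff cov D hp', ← coordDist_apply hp'] at h2
    exact h2
  have hmem := (chartDeriv_mem_coordDist hs).2 hvD
  have key := lieBracket_modelSpray_mem (hcov.contDiffAt_christoffel v.proj)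
    (hrestrict.eventually_modelCov_mem v.proj) (fun u hu => hD.exists_isSectionNear hs hu)
    (fun u hu w hw => htorsion.christoffel_mem hu hw) hmem hξc hξD
  have h1 := chartDeriv_mlieBracket (I := 𝓘(ℝ, E).tangent) (V := spray cov)
    (W := ξ) (x₀ := v)
  rw [(coordRep_spray_eventuallyEq v).lieBracket_vectorField_eq EventuallyEq.rfl, hΦ] at h1
  rw [mem_map_splitting_iff cov D hs, ← coordDist_apply hs]
  rw [h1]
  exact key

/-- Since `hlft Y = vlft (∇_v Y) - [Z, vlft Y]`, horizontal lifts of `D` lie in the hull, at every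
`v` and not only at `v ∈ D`. -/
lemma map_splitting_le_invariantHull (hcov : IsAnalyticConnection cov)
    (hD : IsAnalyticDistribution 𝓘(ℝ, E) D) (hrestrict : RestrictsTo cov D)
    (v : TangentBundle 𝓘(ℝ, E) Q) :
    ((D v.proj).prod (D v.proj)).map (splitting cov v).toLinearMap ≤
      invariantHull 𝓘(ℝ, E).tangent (spray cov) (vliftDist D) v := by
  set F := invariantHull 𝓘(ℝ, E).tangent (spray cov) (vliftDist D)
  have hF : vliftDist D ≤ F := le_invariantHull
  have hvl (w) (hw : w ∈ D v.proj) : vlift v w ∈ F v := hF v (Submodule.mem_map_of_mem hw)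
  rintro _ ⟨⟨a, b⟩, ⟨ha, hb⟩, rfl⟩
  refine (F v).add_mem ?_ (hvl b hb)
  obtain ⟨U, hU, hqU, Y, hY, rfl⟩ := hD v.proj a ha
  have hs := mem_extChartAt_source (I := 𝓘(ℝ, E)) v.proj
  have h1 := isInvariantUnder_invariantHull (Z := spray cov) (S := vliftDist D) _ _
    (hU.preimage (FiberBundle.continuous_proj E (TangentSpace 𝓘(ℝ, E))))
    ((hY.vliftField hU).mono hF) v hqU
  have hYd := ((hY.1 _ hqU).contMDiffAt (hU.mem_nhds hqU)).mdifferentiableAt (by simp)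
  rw [mlieBracket_spray_vliftField hcov hYd] at h1
  have h2 : cov Y v.proj v.snd ∈ D v.proj := by
    -- The restriction hypothesis needs a vector field as direction, so `v` is extended with
    -- constant components; this extension is analytic on the chart domain.
    have h3 := hrestrict (U ∩ (extChartAt 𝓘(ℝ, E) v.proj).source)
      (constField 𝓘(ℝ, E) v.proj (chartDeriv 𝓘(ℝ, E) v.proj v.proj v.snd)) Y
      (hU.inter (isOpen_extChartAt_source _))
      (fun x hx => (contMDiffAt_constField hx.2 _).contMDiffWithinAt)
      ⟨hY.1.mono inter_subset_left, fun x hx => hY.2 x hx.1⟩ v.proj ⟨hqU, hs⟩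
    rwa [constField_chartDeriv hs] at h3
  have h4 := (F v).sub_mem (hvl _ h2) h1
  rwa [sub_sub_cancel] at h4

end SprayDistribution

end AffineSpray

end

theorem mainTheorem4 {E : Type*} [NormedAddCommGroup E] [NormedSpace ℝ E] [FiniteDimensional ℝ E]
    {Q : Type*} [TopologicalSpace Q] [T2Space Q] [ParacompactSpace Q] [ChartedSpace E Q]
    [IsManifold 𝓘(ℝ, E) ω Q]
    (cov : CovariantDerivative 𝓘(ℝ, E) E (TangentSpace 𝓘(ℝ, E) : Q → Type _))
    (hcov : AffineSpray.IsAnalyticConnection cov)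
    (D : ∀ q : Q, Submodule ℝ (TangentSpace 𝓘(ℝ, E) q))
    (hD : AffineSpray.IsAnalyticDistribution 𝓘(ℝ, E) D)
    (hrestrict : AffineSpray.RestrictsTo cov D)
    (htorsion : AffineSpray.TorsionPreserves cov D) :
    ∃ DZ : ∀ v : TangentBundle 𝓘(ℝ, E) Q, Submodule ℝ (TangentSpace 𝓘(ℝ, E).tangent v),
      IsLeast {F : ∀ v : TangentBundle 𝓘(ℝ, E) Q, Submodule ℝ (TangentSpace 𝓘(ℝ, E).tangent v) |
        AffineSpray.IsAnalyticDistribution 𝓘(ℝ, E).tangent F ∧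
        AffineSpray.ContainsVerticalLift D F ∧
        AffineSpray.IsInvariantUnder 𝓘(ℝ, E).tangent (AffineSpray.spray cov) F} DZ ∧
      ∀ v : TangentBundle 𝓘(ℝ, E) Q, v.snd ∈ D v.proj →
        DZ v = ((D v.proj).prod (D v.proj)).map (AffineSpray.splitting cov v).toLinearMap := by
  have : CompleteSpace E := FiniteDimensional.complete ℝ E
  refine ⟨AffineSpray.invariantHull 𝓘(ℝ, E).tangent (AffineSpray.spray cov)
    (AffineSpray.vliftDist D), ⟨⟨?_, ?_, ?_⟩, ?_⟩, fun v hv => le_antisymm ?_ ?_⟩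
  · exact AffineSpray.isAnalyticDistribution_invariantHull hcov.isAnalyticFieldOn_spray
      hD.vliftDist
  · exact AffineSpray.containsVerticalLift_iff.2 AffineSpray.le_invariantHull
  · exact AffineSpray.isInvariantUnder_invariantHull
  · rintro F ⟨-, hF, hZ⟩
    exact AffineSpray.invariantHull_le (AffineSpray.containsVerticalLift_iff.1 hF) hZ
  -- Minimality of the hull against `splitDist`, which need not be analytic; at `v ∈ D` it is
  -- exactly `D ⊕ D`.
  · exact fun X hX => AffineSpray.mem_splitDist.1 (AffineSpray.invariantHull_le
      AffineSpray.vliftDist_le_splitDist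
      (AffineSpray.isInvariantUnder_splitDist hcov hD hrestrict htorsion) v hX) hv
  · exact AffineSpray.map_splitting_le_invariantHull hcov hD hrestrict v
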